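/- Let $K$ be a field of characteristic $0$, let $g\ge 1$ be an integer and let $t\in K$ with $t\ne 0,1$. Put \[j(x)=\sum_{i=0}^{g-1}\binom{2g-1}{2i}(x+1)^i .\] Then $E_t:\ y^2=x(x+1)(x+t)$ is an elliptic curve over $K$; the affine curve \[C_t:\ y^2=x(x+1)\bigl(x^{2g-1}+t\,j(x)^2\bigr)\] is smooth, and its smooth projective model (also denoted $C_t$) has genus $g$. With \[f_1(x)=\frac{x^{2g-1}}{j(x)^2},\qquad f_2(x)=\frac{x^{g-1}\sum_{i=0}^{g-1}\binom{2g-1}{2i+1}(x+1)^i}{j(x)^3},\] the formula $(x,y)\mapsto(f_1(x),f_2(x)\,y)$ defines a morphism $f:C_t\to E_t$ of smooth projective curves of degree $2g-1$. It is totally ramified above $(0,0)\in E_t$, that is, $f^{-1}((0,0))$ consists of the single point $(0,0)\in C_t$, where the ramification index is $2g-1$; and $f$ is unramified at every other closed point of $C_t$. -/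

import Mathlib

open Polynomial

/-! ## The curves and the rational functions -/

namespace Origami

/-- `j(x) = ∑_{i=0}^{g-1} C(2g-1, 2i) (x+1)^i`, for an element `x` of a commutative ring. -/
def jSum {R : Type*} [CommRing R] (g : ℕ) (x : R) : R :=
  ∑ i ∈ Finset.range g, ((2 * g - 1).choose (2 * i) : R) * (x + 1) ^ i

/-- `∑_{i=0}^{g-1} C(2g-1, 2i+1) (x+1)^i`, for an element `x` of a commutative ring. -/
def oddSum {R : Type*} [CommRing R] (g : ℕ) (x : R) : R :=
  ∑ i ∈ Finset.range g, ((2 * g - 1).choose (2 * i + 1) : R) * (x + 1) ^ i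

/-- `f₁(x) = x^{2g-1} / j(x)^2`. -/
noncomputable def f₁ {L : Type*} [Field L] (g : ℕ) (x : L) : L :=
  x ^ (2 * g - 1) / jSum g x ^ 2

/-- `f₂(x) = x^{g-1} ∑_i C(2g-1, 2i+1) (x+1)^i / j(x)^3`. -/
noncomputable def f₂ {L : Type*} [Field L] (g : ℕ) (x : L) : L :=
  x ^ (g - 1) * oddSum g x / jSum g x ^ 3

section Curves

variable {K : Type*} [Field K]

/-- The right-hand side `x (x + 1) (x^{2g-1} + t j(x)^2)` of the equation of `C_t`. -/
noncomputable def curvePoly (g : ℕ) (t : K) : K[X] :=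
  X * (X + 1) * (X ^ (2 * g - 1) + C t * jSum g (X : K[X]) ^ 2)

/-- The affine coordinate ring `K[x, y] / (y² - x (x + 1) (x^{2g-1} + t j(x)^2))` of `C_t`. The
outer variable of `K[X][X]` is `y`. -/
abbrev CurveRing (g : ℕ) (t : K) : Type _ :=
  AdjoinRoot ((X : K[X][X]) ^ 2 - C (curvePoly g t))

lemma natDegree_jSum_le (g : ℕ) : (jSum g (X : K[X])).natDegree ≤ g - 1 := by
  refine natDegree_sum_le_of_forall_le _ _ fun i hi => ?_
  have hi' : i ≤ g - 1 := by have := Finset.mem_range.mp hi; omega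
  refine le_trans ?_ hi'
  have h1 : ((X : K[X]) + 1).natDegree = 1 := by simpa using natDegree_X_add_C (1 : K)
  calc _ ≤ _ := natDegree_mul_le
    _ ≤ i := by simp [natDegree_pow, h1]

lemma curvePoly_ne_sq (g : ℕ) (t : K) (r : K[X]) : r ^ 2 ≠ curvePoly g t := by
  intro h
  rcases Nat.eq_zero_or_pos g with rfl | hg
  · have hF : curvePoly 0 t = X * (X + 1) := by simp [curvePoly, jSum]
    rw [hF] at h
    have h0 : r.eval 0 = 0 := by
      have := congrArg (eval 0) h
      simpa using this
    have h1 := congrArg (fun p => eval 0 (derivative p)) h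
    simp [derivative_pow, h0] at h1
  · have hX1 : ((X : K[X]) + 1).natDegree = 1 := by simpa using natDegree_X_add_C (1 : K)
    have hlt : (C t * jSum g (X : K[X]) ^ 2).natDegree < ((X : K[X]) ^ (2 * g - 1)).natDegree := by
      have h1 := natDegree_jSum_le (K := K) g
      have h2 : (C t * jSum g (X : K[X]) ^ 2).natDegree ≤ 2 * (g - 1) :=
        (natDegree_C_mul_le _ _).trans (natDegree_pow_le.trans (by omega))
      rw [natDegree_X_pow]
      omega
    have hG : (X ^ (2 * g - 1) + C t * jSum g (X : K[X]) ^ 2).natDegree = 2 * g - 1 := by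
      rw [natDegree_add_eq_left_of_natDegree_lt hlt, natDegree_X_pow]
    have hG0 : (X ^ (2 * g - 1) + C t * jSum g (X : K[X]) ^ 2) ≠ 0 := by
      intro h0
      rw [h0, natDegree_zero] at hG
      omega
    have hX10 : (X : K[X]) + 1 ≠ 0 := by
      intro h0
      rw [h0, natDegree_zero] at hX1
      omega
    have hd := congrArg natDegree h
    rw [curvePoly, natDegree_pow, natDegree_mul (mul_ne_zero X_ne_zero hX10) hG0,
      natDegree_mul X_ne_zero hX10, hG, hX1, natDegree_X] at hd
    omega

lemma irreducible_curve (g : ℕ) (t : K) :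
    Irreducible ((X : K[X][X]) ^ 2 - C (curvePoly g t)) := by
  have hd : ((X : K[X][X]) ^ 2 - C (curvePoly g t)).natDegree = 2 :=
    natDegree_X_pow_sub_C
  have hm : ((X : K[X][X]) ^ 2 - C (curvePoly g t)).Monic :=
    monic_X_pow_sub_C _ two_ne_zero
  rw [hm.irreducible_iff_roots_eq_zero_of_degree_le_three (by omega) (by omega)]
  refine Multiset.eq_zero_of_forall_notMem fun r hr => ?_
  have := (mem_roots'.mp hr).2
  simp only [IsRoot.def, eval_sub, eval_pow, eval_X, eval_C] at this
  exact curvePoly_ne_sq g t r (sub_eq_zero.mp this)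

instance (g : ℕ) (t : K) : IsDomain (CurveRing g t) :=
  AdjoinRoot.isDomain_of_prime (irreducible_curve g t).prime

/-- The function field `K(C_t)`. -/
abbrev CurveField (g : ℕ) (t : K) : Type _ := FractionRing (CurveRing g t)

/-- The coordinate function `x` on `C_t`. -/
noncomputable def xC (g : ℕ) (t : K) : CurveField g t :=
  algebraMap (CurveRing g t) _ (AdjoinRoot.of _ X)

/-- The coordinate function `y` on `C_t`. -/
noncomputable def yC (g : ℕ) (t : K) : CurveField g t :=
  algebraMap (CurveRing g t) _ (AdjoinRoot.root _)

/-- The Weierstrass curve `E_t : y² = x (x + 1) (x + t) = x³ + (1 + t) x² + t x`. -/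
def curveE (t : K) : WeierstrassCurve.Affine K where
  a₁ := 0
  a₂ := 1 + t
  a₃ := 0
  a₄ := t
  a₆ := 0

lemma curveE_equation (t a b : K) :
    (curveE t).Equation a b ↔ b ^ 2 = a * (a + 1) * (a + t) := by
  rw [WeierstrassCurve.Affine.equation_iff]
  simp only [curveE]
  constructor <;> intro h <;> linear_combination h

/-- The coordinate function `x` on `E_t`. -/
noncomputable def xE (t : K) : (curveE t).FunctionField :=
  algebraMap (curveE t).CoordinateRing _ (AdjoinRoot.of _ X)

/-- The coordinate function `y` on `E_t`. -/
noncomputable def yE (t : K) : (curveE t).FunctionField :=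
  algebraMap (curveE t).CoordinateRing _ (AdjoinRoot.root _)

end Curves

/-! ## The smooth projective curve with a given function field -/

/-- A (closed) point of the smooth projective curve over `K` with function field `L`: a valuation
ring of `L` that contains `K` and is not `L` itself. As `L` is finitely generated of transcendence
degree one over `K`, these are the discrete valuation rings of `L` over `K`, that is, the local
rings of the curve at its closed points. -/
@[ext]
structure Point (K L : Type*) [Field K] [Field L] [Algebra K L] where
  /-- The local ring at the point. -/
  ring : ValuationSubring L
  algebraMap_mem : ∀ c : K, algebraMap K L c ∈ ring
  ne_top : ring ≠ ⊤

section Points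

variable {K L : Type*} [Field K] [Field L] [Algebra K L]

/-- `P` is the point `(a, b)` in terms of the coordinate functions `x` and `y`: the functions
`x - a` and `y - b` vanish at `P`, i.e. lie in the maximal ideal of the local ring at `P`. -/
def Point.IsAt (P : Point K L) (x y : L) (a b : K) : Prop :=
  x - algebraMap K L a ∈ P.ring.nonunits ∧ y - algebraMap K L b ∈ P.ring.nonunits

/-- The differential `ω` is regular at `P`: it is of the form `∑ uᵢ dvᵢ` with `uᵢ`, `vᵢ` in the
local ring at `P`. -/
def Point.IsRegularAt (P : Point K L) (ω : Ω[L⁄K]) : Prop :=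
  ω ∈ Submodule.span P.ring (Set.range fun v : P.ring => KaehlerDifferential.D K L (v : L))

variable (K L) in
/-- The `K`-vector space of the global regular differentials on the smooth projective curve with
function field `L`. -/
noncomputable def regularDifferentials : Submodule K Ω[L⁄K] where
  carrier := {ω | ∀ P : Point K L, P.IsRegularAt ω}
  zero_mem' P := Submodule.zero_mem _
  add_mem' h₁ h₂ P := Submodule.add_mem _ (h₁ P) (h₂ P)
  smul_mem' c ω h P := by
    have h' := Submodule.smul_mem _ (⟨algebraMap K L c, P.algebraMap_mem c⟩ : P.ring) (h P)
    have e : (⟨algebraMap K L c, P.algebraMap_mem c⟩ : P.ring) • ω = c • ω :=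
      algebraMap_smul L c ω
    rw [e] at h'
    exact h'

variable (K L) in
/-- The genus of the smooth projective curve with function field `L`: the dimension of the space of
its global regular differentials. -/
noncomputable def genus : ℕ := Module.finrank K (regularDifferentials K L)

end Points

/-! ## Morphisms of curves -/

/-- A nonconstant morphism, over `K`, from the smooth projective curve with function field `L` to
the one with function field `M`, given by its comorphism `M → L`; it is finite. -/
structure CurveMap (K L M : Type*) [Field K] [Field L] [Field M] [Algebra K L] [Algebra K M] where
  /-- The pullback of rational functions. -/
  pullback : M →ₐ[K] L
  finite : pullback.toRingHom.Finite

namespace CurveMap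

variable {K L M : Type*} [Field K] [Field L] [Field M] [Algebra K L] [Algebra K M]

/-- The degree of a morphism of curves: the degree of the extension of function fields. -/
noncomputable def degree (f : CurveMap K L M) : ℕ :=
  letI := f.pullback.toRingHom.toAlgebra
  Module.finrank M L

/-- The image `f(P)` of a point `P`: its local ring consists of the rational functions whose
pullback is regular at `P`. -/
def onPoints (f : CurveMap K L M) (P : Point K L) : Point K M where
  ring := P.ring.comap f.pullback.toRingHom
  algebraMap_mem c := by
    rw [ValuationSubring.mem_comap]
    have h : f.pullback.toRingHom (algebraMap K M c) = algebraMap K L c := f.pullback.commutes c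
    rw [h]
    exact P.algebraMap_mem c
  ne_top h := by
    refine P.ne_top (top_unique fun z _ => ?_)
    have hmem : ∀ m : M, f.pullback.toRingHom m ∈ P.ring := fun m => by
      rw [← ValuationSubring.mem_comap, h]
      exact ValuationSubring.mem_top m
    obtain ⟨p, hp, hz⟩ := f.finite.to_isIntegral z
    have hz' : IsIntegral P.ring z := by
      refine ⟨p.map (f.pullback.toRingHom.codRestrict P.ring hmem), hp.map _, ?_⟩
      rw [eval₂_map]
      exact hz
    obtain ⟨w, rfl⟩ := IsIntegrallyClosed.isIntegral_iff.mp hz'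
    exact w.2

/-- The homomorphism of local rings from the local ring at `f(P)` to the local ring at `P`. -/
def localHom (f : CurveMap K L M) (P : Point K L) : (f.onPoints P).ring →+* P.ring :=
  (f.pullback.toRingHom.comp (f.onPoints P).ring.subtype).codRestrict P.ring fun v => v.2

/-- The ramification index of `f` at `P`: the exponent `e` such that the maximal ideal at `f(P)`
generates the `e`-th power of the maximal ideal at `P`. -/
noncomputable def ramificationIdx (f : CurveMap K L M) (P : Point K L) : ℕ :=
  letI := (f.localHom P).toAlgebra
  Ideal.ramificationIdx' (IsLocalRing.maximalIdeal (f.onPoints P).ring)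
    (IsLocalRing.maximalIdeal P.ring)

end CurveMap

end Origami

/-! Write n = 2g-1 and o for `oddSum`. With x = s²-1, the polynomials j and o are the even and odd
parts of a binomial power: (1+s)^n = j + s o and (1-s)^n = j - s o. Multiplying gives j² + x^n =
(x+1) o² (`jSum_sq_add`); differentiating gives n j - 2x j' = n o (`derivative_jSum`). By the first,
f₁ + 1 = (x+1) o²/j², so (f₁, f₂ y) satisfies the equation of E_t. By the second, df₁ = n x^(g-1) f₂
dx, so dx/y on E_t pulls back to n x^(g-1) dx/y on C_t. Together they also show that the right-hand
side of C_t is separable.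

The differential dx/y has no zeros or poles on E_t, while x^(g-1) dx/y vanishes on C_t at most at
(0,0): at infinity it is -du/v for u = 1/x, v = y/x^(g+1). Hence f is unramified away from (0,0). At
(0,0), y is a uniformizer on both curves and f₂ y is a unit times y^n, so the index is n; no other
point lies above, because f₁ has poles at infinity. For the degree, x is a root of the monic
polynomial T^n - f₁ j(T)², and no relation of smaller degree exists because f₁ is a unit times x^n
at (0,0) (`eq_zero_of_sum_aeval_f₁`).

C_t, E_t and their charts at infinity are all instances of `IsHyperelliptic`. Points are abstract
valuation rings; `exists_mul_eq` makes them concrete, as localizations of K[x, y] wherever x is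
regular. Differentials are handled through the derivation D with D x = y, dual to dx/y: ω becomes
the function ω/(dx/y), and regularity becomes membership in a local ring. Comparing the two charts
leaves the p(x) dx/y with deg p < g, whence the genus. -/

namespace Origami

/-! ### Greatest common divisors and squarefree polynomials -/

section Polynomials

variable {K : Type*} [Field K]

/-- In `K[X]`, a greatest common divisor of two polynomials, with cofactors. -/
lemma exists_isCoprime_cofactors (a b : K[X]) (ha : a ≠ 0) :
    ∃ d a' b' : K[X], d ≠ 0 ∧ a = d * a' ∧ b = d * b' ∧ IsCoprime a' b' := by
  obtain ⟨d, hd⟩ := IsPrincipalIdealRing.principal (Ideal.span {a, b})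
  have h1 : a ∈ Ideal.span {d} := by
    rw [← Ideal.submodule_span_eq, ← hd]; exact Ideal.subset_span (by simp)
  have h2 : b ∈ Ideal.span {d} := by
    rw [← Ideal.submodule_span_eq, ← hd]; exact Ideal.subset_span (by simp)
  have h3 : d ∈ Ideal.span {a, b} := by rw [hd]; exact Ideal.subset_span (by simp)
  obtain ⟨a', rfl⟩ := Ideal.mem_span_singleton.mp h1
  obtain ⟨b', rfl⟩ := Ideal.mem_span_singleton.mp h2
  obtain ⟨u, v, huv⟩ := Ideal.mem_span_pair.mp h3
  have hd0 : d ≠ 0 := left_ne_zero_of_mul ha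
  exact ⟨d, a', b', hd0, rfl, rfl, u, v, mul_left_cancel₀ hd0 (by linear_combination huv)⟩

/-- Serves to make a quadratic equation over K[x] primitive. -/
lemma exists_gcd_three (a b c : K[X]) (ha : a ≠ 0) :
    ∃ d a' b' c' u v w : K[X], d ≠ 0 ∧ a = d * a' ∧ b = d * b' ∧ c = d * c' ∧
      u * a' + v * b' + w * c' = 1 := by
  obtain ⟨d, a', b', hd, rfl, rfl, u, v, huv⟩ := exists_isCoprime_cofactors a b ha
  obtain ⟨e, d', c', he, rfl, rfl, u', v', huv'⟩ := exists_isCoprime_cofactors d c hd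
  exact ⟨e, d' * a', d' * b', c', u' * u, u' * v, v', he, by ring, by ring, rfl,
    by linear_combination huv' + u' * d' * huv⟩

/-- Once the gcd of d and w is removed, the square of what remains of d is coprime to w and so
divides F; that remainder is a unit. -/
lemma dvd_of_sq_dvd_sq_mul_squarefree {F d w : K[X]} (hF : Squarefree F) (hd : d ≠ 0)
    (h : d ^ 2 ∣ w ^ 2 * F) : d ∣ w := by
  obtain ⟨e, d', w', he, rfl, rfl, hc⟩ := exists_isCoprime_cofactors d w hd
  rw [mul_pow, mul_pow, mul_assoc, mul_dvd_mul_iff_left (pow_ne_zero 2 he)] at h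
  have h' : d' * d' ∣ F := by
    rw [← pow_two]
    exact (hc.pow (m := 2) (n := 2)).dvd_of_dvd_mul_left h
  exact mul_dvd_mul_left e (isUnit_iff_dvd_one.mp (hF d' h') |>.trans (one_dvd _))

end Polynomials

/-! ### Units and nonunits of local rings, values of polynomials -/

section Points

variable {K L : Type*} [Field K] [Field L] [Algebra K L]

namespace Point

variable (P : Point K L)

lemma aeval_mem {x : L} (hx : x ∈ P.ring) (p : K[X]) : aeval x p ∈ P.ring := by
  rw [aeval_eq_sum_range]
  refine sum_mem fun i _ => ?_
  rw [Algebra.smul_def]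
  exact mul_mem (P.algebraMap_mem _) (pow_mem hx i)

lemma mem_of_mem_nonunits {z : L} (hz : z ∈ P.ring.nonunits) : z ∈ P.ring :=
  P.ring.nonunits_le hz

lemma mul_mem_nonunits {z w : L} (hz : z ∈ P.ring) (hw : w ∈ P.ring.nonunits) :
    z * w ∈ P.ring.nonunits := by
  rw [ValuationSubring.mem_nonunits_iff] at hw ⊢
  rw [map_mul]
  exact (mul_le_of_le_one_left' ((P.ring.valuation_le_one_iff z).mpr hz)).trans_lt hw

lemma inv_mem {z : L} (hz : z ∉ P.ring.nonunits) : z⁻¹ ∈ P.ring := by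
  rw [ValuationSubring.mem_nonunits_iff, not_lt] at hz
  rw [← ValuationSubring.valuation_le_one_iff, map_inv₀]
  exact inv_le_one_of_one_le₀ hz

lemma one_notMem_nonunits : (1 : L) ∉ P.ring.nonunits := by
  simp [ValuationSubring.mem_nonunits_iff]

lemma algebraMap_notMem_nonunits {c : K} (hc : c ≠ 0) : algebraMap K L c ∉ P.ring.nonunits := by
  intro h
  have := P.mul_mem_nonunits (P.algebraMap_mem c⁻¹) h
  rw [← map_mul, inv_mul_cancel₀ hc, map_one] at this
  exact P.one_notMem_nonunits this

lemma mem_nonunits_of_mul_mem {z w : L} (h : z * w ∈ P.ring.nonunits)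
    (hz : z ∉ P.ring.nonunits) : w ∈ P.ring.nonunits := by
  have hz0 : z ≠ 0 := by rintro rfl; exact hz (zero_mem _)
  have := P.mul_mem_nonunits (P.inv_mem hz) h
  rwa [inv_mul_cancel_left₀ hz0] at this

lemma mem_nonunits_of_pow_mem {z : L} {n : ℕ} (h : z ^ n ∈ P.ring.nonunits) :
    z ∈ P.ring.nonunits := by
  rw [ValuationSubring.mem_nonunits_iff] at h ⊢
  by_contra! h'
  rw [map_pow] at h
  exact absurd h (not_lt.mpr (one_le_pow₀ h'))

lemma mem_of_mul_mem {z w : L} (h : z * w ∈ P.ring) (hz : z ∉ P.ring.nonunits) : w ∈ P.ring := by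
  have hz0 : z ≠ 0 := by rintro rfl; exact hz (zero_mem _)
  have := mul_mem (P.inv_mem hz) h
  rwa [inv_mul_cancel_left₀ hz0] at this

lemma mem_of_pow_mem {z : L} {n : ℕ} (hn : n ≠ 0) (h : z ^ n ∈ P.ring) : z ∈ P.ring := by
  rw [← ValuationSubring.valuation_le_one_iff] at h ⊢
  by_contra! h'
  rw [map_pow] at h
  exact absurd h (not_le.mpr (one_lt_pow₀ h' hn))

lemma inv_mem_nonunits_of_notMem {z : L} (hz : z ∉ P.ring) : z⁻¹ ∈ P.ring.nonunits :=
  P.ring.inv_mem_nonunits_iff.mpr (Or.inr hz)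

lemma aeval_sub_mem_nonunits {x : L} {a : K} (hx : x - algebraMap K L a ∈ P.ring.nonunits)
    (p : K[X]) : aeval x p - algebraMap K L (p.eval a) ∈ P.ring.nonunits := by
  have hx' : x ∈ P.ring := by
    have := add_mem (P.mem_of_mem_nonunits hx) (P.algebraMap_mem a)
    rwa [sub_add_cancel] at this
  have hdvd : X - C a ∣ p - C (p.eval a) := by
    rw [dvd_iff_isRoot]; simp
  obtain ⟨q, hq⟩ := hdvd
  have := congrArg (aeval x) hq
  simp only [map_sub, map_mul, aeval_X, aeval_C] at this
  rw [this, mul_comm]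
  exact P.mul_mem_nonunits (P.aeval_mem hx' q) hx

lemma aeval_mem_nonunits_iff {x : L} (hx : x ∈ P.ring.nonunits) (p : K[X]) :
    aeval x p ∈ P.ring.nonunits ↔ p.eval 0 = 0 := by
  have h := P.aeval_sub_mem_nonunits (a := 0) (by simpa using hx) p
  constructor
  · intro hp
    by_contra h0
    exact P.algebraMap_notMem_nonunits h0 (by simpa using sub_mem hp h)
  · intro h0
    simpa [h0] using h

lemma isAt_zero_iff {x y : L} :
    P.IsAt x y 0 0 ↔ x ∈ P.ring.nonunits ∧ y ∈ P.ring.nonunits := by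
  simp [IsAt]

end Point

end Points

/-! ### Local rings of the curve y² = F(x) where x is regular -/

/-- The functions `x`, `y` generate the field `L` over `K` and satisfy `y² = F(x)` with a separable
polynomial `F`, and no other algebraic relation. -/
structure IsHyperelliptic {K L : Type*} [Field K] [Field L] [Algebra K L] (x y : L) (F : K[X]) :
    Prop where
  sq : y ^ 2 = aeval x F
  separable : F.Separable
  gen : ∀ z : L, ∃ a b c : K[X], c ≠ 0 ∧ aeval x c * z = aeval x a + aeval x b * y
  indep : ∀ a b : K[X], aeval x a + aeval x b * y = 0 → a = 0 ∧ b = 0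

namespace IsHyperelliptic

variable {K L : Type*} [Field K] [Field L] [Algebra K L] {x y : L} {F : K[X]}

lemma aeval_eq_zero (h : IsHyperelliptic x y F) {p : K[X]} (hp : aeval x p = 0) : p = 0 :=
  (h.indep p 0 (by simp [hp])).1

lemma aeval_ne_zero (h : IsHyperelliptic x y F) {p : K[X]} (hp : p ≠ 0) : aeval x p ≠ 0 :=
  fun h0 => hp (h.aeval_eq_zero h0)

lemma x_ne_zero (h : IsHyperelliptic x y F) : x ≠ 0 := by
  simpa using h.aeval_ne_zero (X_ne_zero (R := K))

lemma y_ne_zero (h : IsHyperelliptic x y F) : y ≠ 0 := by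
  intro h0
  simpa using (h.indep 0 1 (by simp [h0])).2

lemma y_mem (h : IsHyperelliptic x y F) (P : Point K L) (hx : x ∈ P.ring) : y ∈ P.ring :=
  P.mem_of_pow_mem two_ne_zero (h.sq ▸ P.aeval_mem hx F)

lemma add_mul_mem (h : IsHyperelliptic x y F) (P : Point K L) (hx : x ∈ P.ring) (a b : K[X]) :
    aeval x a + aeval x b * y ∈ P.ring :=
  add_mem (P.aeval_mem hx a) (mul_mem (P.aeval_mem hx b) (h.y_mem P hx))

/-- The local ring at a point where `x` is regular is a localization of `K[x, y]`. -/
lemma exists_mul_eq [CharZero K] (h : IsHyperelliptic x y F) (P : Point K L) (hx : x ∈ P.ring)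
    {z : L} (hz : z ∈ P.ring) :
    ∃ p q r s : K[X], aeval x p + aeval x q * y ∉ P.ring.nonunits ∧
      (aeval x p + aeval x q * y) * z = aeval x r + aeval x s * y := by
  have h2 : IsUnit (2 : K[X]) := by
    rw [← map_ofNat (C : K →+* K[X]) 2, isUnit_C]
    exact isUnit_iff_ne_zero.mpr two_ne_zero
  obtain ⟨a, b, c, hc, hz'⟩ := h.gen z
  -- z is a root of c² T² - 2ac T + (a² - b² F). Dividing the coefficients by their gcd d gives a
  -- primitive equation α T² + β T + γ.
  obtain ⟨d, α, β, γ, u, v, w, hd, hα, hβ, hγ, huvw⟩ :=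
    exists_gcd_three (c ^ 2) (-2 * a * c) (a ^ 2 - b ^ 2 * F) (pow_ne_zero 2 hc)
  have hd1 : d ∣ c * a := by
    rw [← h2.dvd_mul_left]
    exact ⟨-β, by linear_combination -hβ⟩
  have hd2 : d ∣ c * b := by
    refine dvd_of_sq_dvd_sq_mul_squarefree h.separable.squarefree hd ?_
    have e : (c * b) ^ 2 * F = (c * a) ^ 2 - (c ^ 2) * (a ^ 2 - b ^ 2 * F) := by ring
    rw [e]
    exact dvd_sub (pow_dvd_pow_of_dvd hd1 2) ⟨α * γ, by rw [hα, hγ]; ring⟩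
  obtain ⟨a₁, ha₁⟩ := hd1
  obtain ⟨b₁, hb₁⟩ := hd2
  have hdx := h.aeval_ne_zero hd
  have hα' := congrArg (aeval x) hα
  have hβ' := congrArg (aeval x) hβ
  have hγ' := congrArg (aeval x) hγ
  have ha' := congrArg (aeval x) ha₁
  have hb' := congrArg (aeval x) hb₁
  have hu' := congrArg (aeval x) huvw
  simp only [map_mul, map_pow, map_neg, map_sub, map_add, map_one, map_ofNat] at hα' hβ' hγ' ha' hb' hu'
  have e1 : aeval x α * z = aeval x a₁ + aeval x b₁ * y := by
    apply mul_left_cancel₀ hdx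
    linear_combination (-z) * hα' + aeval x c * hz' + ha' + y * hb'
  have e2 : (aeval x α * z + aeval x β) * z = - aeval x γ := by
    apply mul_left_cancel₀ hdx
    linear_combination (-z ^ 2) * hα' - z * hβ' - hγ' +
      (aeval x c * z - aeval x a + aeval x b * y) * hz' + (aeval x b) ^ 2 * h.sq
  -- Both α and αz + β lie in K[x, y] and multiply z into K[x, y], so either may serve as
  -- denominator. If both were nonunits, so would be β, γ and hence 1 = uα + vβ + wγ.
  by_cases hA : aeval x α ∈ P.ring.nonunits
  · by_cases hB : aeval x α * z + aeval x β ∈ P.ring.nonunits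
    · exfalso
      have hα2 : aeval x α * z ∈ P.ring.nonunits := by
        rw [mul_comm]; exact P.mul_mem_nonunits hz hA
      have hβ2 : aeval x β ∈ P.ring.nonunits := by
        simpa using sub_mem hB hα2
      have hγ2 : aeval x γ ∈ P.ring.nonunits := by
        have : aeval x γ = -(z * (aeval x α * z + aeval x β)) := by linear_combination e2
        rw [this]
        exact neg_mem (P.mul_mem_nonunits hz hB)
      refine P.one_notMem_nonunits ?_
      rw [← hu']
      exact add_mem (add_mem (P.mul_mem_nonunits (P.aeval_mem hx u) hA)
        (P.mul_mem_nonunits (P.aeval_mem hx v) hβ2)) (P.mul_mem_nonunits (P.aeval_mem hx w) hγ2)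
    · have e3 : aeval x α * z + aeval x β = aeval x (a₁ + β) + aeval x b₁ * y := by
        rw [e1, map_add]; ring
      refine ⟨a₁ + β, b₁, -γ, 0, e3 ▸ hB, ?_⟩
      rw [← e3, e2]; simp
  · exact ⟨α, 0, a₁, b₁, by simpa using hA, by simpa using e1⟩

/-- The subring `K[x, y]`. -/
def coordinateSubring (h : IsHyperelliptic x y F) : Subring L where
  carrier := {w | ∃ a b : K[X], w = aeval x a + aeval x b * y}
  mul_mem' := by
    rintro _ _ ⟨a, b, rfl⟩ ⟨c, d, rfl⟩
    refine ⟨a * c + b * d * F, a * d + b * c, ?_⟩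
    simp only [map_add, map_mul, ← h.sq]; ring
  one_mem' := ⟨1, 0, by simp⟩
  add_mem' := by
    rintro _ _ ⟨a, b, rfl⟩ ⟨c, d, rfl⟩
    exact ⟨a + c, b + d, by simp only [map_add]; ring⟩
  zero_mem' := ⟨0, 0, by simp⟩
  neg_mem' := by
    rintro _ ⟨a, b, rfl⟩
    exact ⟨-a, -b, by simp only [map_neg]; ring⟩

/-- A function that is regular wherever `x` is regular is a polynomial in `x` and `y`. -/
lemma exists_eq_of_forall_mem [CharZero K] (h : IsHyperelliptic x y F) {z : L}
    (hz : ∀ P : Point K L, x ∈ P.ring → z ∈ P.ring) :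
    ∃ a b : K[X], z = aeval x a + aeval x b * y := by
  let A := h.coordinateSubring
  -- The ideal of denominators of z. If it is proper, its elements are nonunits in some valuation
  -- ring containing K[x, y]; but z is regular there and `exists_mul_eq` provides a denominator that
  -- is not a nonunit.
  let I : Ideal A :=
    { carrier := {s | (s : L) * z ∈ A}
      add_mem' := fun {s t} hs ht => by
        have : ((s + t : A) : L) * z = s * z + t * z := by push_cast; ring
        simpa only [Set.mem_ofPred_eq, this] using add_mem hs ht
      zero_mem' := by simp [zero_mem]
      smul_mem' := fun c s hs => by
        have : ((c • s : A) : L) * z = c * (s * z) := by simp [mul_assoc]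
        simpa only [Set.mem_ofPred_eq, this] using mul_mem c.2 hs }
  by_cases hI : I = ⊤
  · have : (1 : A) ∈ I := hI ▸ Submodule.mem_top
    have h1 : ((1 : A) : L) * z ∈ A := this
    simpa using! h1
  · exfalso
    obtain ⟨V, hAV, hIV⟩ := Ideal.image_subset_nonunits_valuationSubring I hI
    have hI' : ∀ s ∈ A, s * z ∈ A → s ∈ V.nonunits := fun s hs hsz =>
      hIV ⟨⟨s, hs⟩, hsz, rfl⟩
    obtain ⟨a, b, c, hc, hc'⟩ := h.gen z
    have hcV := hI' (aeval x c) ⟨c, 0, by simp⟩ ⟨a, b, hc'⟩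
    let P : Point K L :=
      { ring := V
        algebraMap_mem := fun k => hAV ⟨C k, 0, by simp⟩
        ne_top := by
          rintro rfl
          rw [ValuationSubring.mem_nonunits_iff_or] at hcV
          rcases hcV with h0 | h0
          · exact h.aeval_ne_zero hc h0
          · exact h0 (ValuationSubring.mem_top _) }
    have hxP : x ∈ P.ring := hAV ⟨X, 0, by simp⟩
    obtain ⟨p, q, r, s, h1, h2⟩ := h.exists_mul_eq P hxP (hz P hxP)
    exact h1 (hI' _ ⟨p, q, rfl⟩ ⟨r, s, h2⟩)

lemma y_mem_nonunits (h : IsHyperelliptic x y F) (hF : F.eval 0 = 0) (P : Point K L)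
    (hx : x ∈ P.ring.nonunits) : y ∈ P.ring.nonunits :=
  P.mem_nonunits_of_pow_mem (n := 2) (h.sq ▸ (P.aeval_mem_nonunits_iff hx F).mpr hF)

lemma isAt_zero_iff (h : IsHyperelliptic x y F) (hF : F.eval 0 = 0) (P : Point K L) :
    P.IsAt x y 0 0 ↔ x ∈ P.ring.nonunits := by
  rw [P.isAt_zero_iff]
  exact ⟨fun h => h.1, fun hx => ⟨hx, h.y_mem_nonunits hF P hx⟩⟩

lemma add_mul_mem_nonunits_iff (h : IsHyperelliptic x y F) (hF : F.eval 0 = 0) (P : Point K L)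
    (hx : x ∈ P.ring.nonunits) (p q : K[X]) :
    aeval x p + aeval x q * y ∈ P.ring.nonunits ↔ p.eval 0 = 0 := by
  have hq := P.mul_mem_nonunits (P.aeval_mem (P.mem_of_mem_nonunits hx) q)
    (h.y_mem_nonunits hF P hx)
  rw [← P.aeval_mem_nonunits_iff hx p]
  exact ⟨fun hp => by simpa using sub_mem hp hq, fun hp => add_mem hp hq⟩

lemma exists_point_zero (h : IsHyperelliptic x y F) (hF : F.eval 0 = 0) :
    ∃ P : Point K L, x ∈ P.ring.nonunits := by
  let A := h.coordinateSubring
  have hx : x ∈ A := ⟨X, 0, by simp⟩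
  have hy : y ∈ A := ⟨0, 1, by simp⟩
  -- The y-free part of 1 = (a + b y) x + (c + d y) y reads 1 = aX + dF, which fails at 0.
  have hI : Ideal.span {(⟨x, hx⟩ : A), ⟨y, hy⟩} ≠ ⊤ := by
    rw [Ne, Ideal.eq_top_iff_one, Ideal.mem_span_pair]
    rintro ⟨⟨_, a, b, rfl⟩, ⟨_, c, d, rfl⟩, e⟩
    have e' := congrArg Subtype.val e
    simp only [Subring.coe_add, Subring.coe_mul, Subring.coe_one] at e'
    have := (h.indep (a * X + d * F - 1) (b * X + c) (by
      simp only [map_add, map_sub, map_mul, map_one, aeval_X, ← h.sq]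
      linear_combination e')).1
    simpa [hF] using congrArg (eval 0) this
  obtain ⟨V, hAV, hIV⟩ := Ideal.image_subset_nonunits_valuationSubring _ hI
  have hxV : x ∈ V.nonunits := hIV ⟨⟨x, hx⟩, Ideal.subset_span (by simp), rfl⟩
  refine ⟨⟨V, fun k => hAV ⟨C k, 0, by simp⟩, ?_⟩, hxV⟩
  rintro rfl
  rw [ValuationSubring.mem_nonunits_iff_or] at hxV
  rcases hxV with h0 | h0
  · exact h.x_ne_zero h0
  · exact h0 (ValuationSubring.mem_top _)

/-- Wherever x vanishes, whether p + q y is a nonunit depends only on p(0). So a fraction with an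
admissible denominator at one such point has one at any other. -/
lemma point_zero_unique [CharZero K] (h : IsHyperelliptic x y F) (hF : F.eval 0 = 0)
    {P Q : Point K L} (hP : x ∈ P.ring.nonunits) (hQ : x ∈ Q.ring.nonunits) : P = Q := by
  have key : ∀ {P Q : Point K L}, x ∈ P.ring.nonunits → x ∈ Q.ring.nonunits →
      P.ring ≤ Q.ring := by
    intro P Q hP hQ z hz
    obtain ⟨p, q, r, s, h1, h2⟩ := h.exists_mul_eq P (P.mem_of_mem_nonunits hP) hz
    rw [h.add_mul_mem_nonunits_iff hF P hP, ← h.add_mul_mem_nonunits_iff hF Q hQ p q] at h1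
    exact Q.mem_of_mul_mem (h2 ▸ h.add_mul_mem Q (Q.mem_of_mem_nonunits hQ) r s) h1
  exact Point.ext (le_antisymm (key hP hQ) (key hQ hP))

/-- Separability makes 0 a simple root of F. -/
lemma eval_divX_ne_zero (h : IsHyperelliptic x y F) (hF : F.eval 0 = 0) : F.divX.eval 0 ≠ 0 := by
  intro h0
  have hF' : F = F.divX * X := by
    conv_lhs => rw [← divX_mul_X_add F]
    simp [coeff_zero_eq_eval_zero, hF]
  have h1 := h.separable.eval₂_derivative_ne_zero (RingHom.id K) (x := 0)
    (by rwa [eval₂_id])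
  apply h1
  rw [eval₂_id, hF']
  simp [h0]

/-- At the point `(0, 0)`, the function `x` is a unit times `y²`. -/
lemma exists_x_eq (h : IsHyperelliptic x y F) (hF : F.eval 0 = 0) (P : Point K L)
    (hx : x ∈ P.ring.nonunits) :
    ∃ w ∈ P.ring, w ∉ P.ring.nonunits ∧ x = w * y ^ 2 := by
  have hu : aeval x F.divX ∉ P.ring.nonunits := by
    rw [P.aeval_mem_nonunits_iff hx]; exact h.eval_divX_ne_zero hF
  have hu0 : aeval x F.divX ≠ 0 := fun h0 => hu (h0 ▸ zero_mem _)
  refine ⟨(aeval x F.divX)⁻¹, P.inv_mem hu, ?_, ?_⟩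
  · rw [ValuationSubring.inv_mem_nonunits_iff]
    push Not
    exact ⟨hu0, P.aeval_mem (P.mem_of_mem_nonunits hx) _⟩
  · have hF' : F = F.divX * X := by
      conv_lhs => rw [← divX_mul_X_add F]
      simp [coeff_zero_eq_eval_zero, hF]
    have : aeval x F = aeval x F.divX * x := by
      conv_lhs => rw [hF']
      simp
    rw [h.sq, this]
    field_simp

/-- At the point `(0, 0)`, the function `y` is a uniformizer. -/
lemma exists_eq_y_mul [CharZero K] (h : IsHyperelliptic x y F) (hF : F.eval 0 = 0)
    (P : Point K L) (hx : x ∈ P.ring.nonunits) {z : L} (hz : z ∈ P.ring.nonunits) :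
    ∃ w ∈ P.ring, z = y * w := by
  have hx' := P.mem_of_mem_nonunits hx
  obtain ⟨p, q, r, s, h1, h2⟩ := h.exists_mul_eq P hx' (P.mem_of_mem_nonunits hz)
  have hr : r.eval 0 = 0 := by
    rw [← h.add_mul_mem_nonunits_iff hF P hx r s, ← h2]
    exact P.mul_mem_nonunits (h.add_mul_mem P hx' p q) hz
  obtain ⟨r', rfl⟩ : X ∣ r := by rwa [X_dvd_iff, coeff_zero_eq_eval_zero]
  obtain ⟨w, hw, -, hxw⟩ := h.exists_x_eq hF P hx
  set t := aeval x p + aeval x q * y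
  have ht0 : t ≠ 0 := fun h0 => h1 (h0 ▸ zero_mem _)
  refine ⟨t⁻¹ * (w * y * aeval x r' + aeval x s),
    mul_mem (P.inv_mem h1) (add_mem (mul_mem (mul_mem hw (h.y_mem P hx')) (P.aeval_mem hx' _))
      (P.aeval_mem hx' _)), ?_⟩
  apply mul_left_cancel₀ ht0
  rw [h2, map_mul, aeval_X]
  have : t * (y * (t⁻¹ * (w * y * aeval x r' + aeval x s))) =
      y * (w * y * aeval x r' + aeval x s) := by field_simp
  rw [this]
  linear_combination aeval x r' * hxw

/-- A nonconstant polynomial in `x` vanishes at every point where `x` is regular. -/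
lemma exists_aeval_mem_nonunits (h : IsHyperelliptic x y F) (P : Point K L) (hx : x ∈ P.ring) :
    ∃ p : K[X], p ≠ 0 ∧ aeval x p ∈ P.ring.nonunits := by
  obtain ⟨w, hw⟩ : ∃ w, w ∉ P.ring := by
    by_contra! hall
    exact P.ne_top (top_unique fun z _ => hall z)
  have hw' := P.inv_mem_nonunits_of_notMem hw
  have hw0 : w⁻¹ ≠ 0 := by
    rintro h0
    rw [inv_eq_zero] at h0
    exact hw (h0 ▸ zero_mem _)
  obtain ⟨a, b, c, hc, hz⟩ := h.gen w⁻¹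
  -- The norm of c w⁻¹ = a + b y is a polynomial in x and a multiple of the nonunit w⁻¹.
  have e : aeval x (a ^ 2 - b ^ 2 * F) = (aeval x c * (aeval x a - aeval x b * y)) * w⁻¹ := by
    simp only [map_sub, map_mul, map_pow, ← h.sq]
    linear_combination -(aeval x a - aeval x b * y) * hz
  refine ⟨a ^ 2 - b ^ 2 * F, ?_, ?_⟩
  · intro h0
    rw [h0, map_zero, zero_eq_mul, mul_eq_zero] at e
    rcases e with (e | e) | e
    · exact h.aeval_ne_zero hc e
    · obtain ⟨ha, hb⟩ := h.indep a (-b) (by simpa [← sub_eq_add_neg] using e)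
      rw [neg_eq_zero] at hb
      rw [ha, hb] at hz
      simp [h.aeval_ne_zero hc] at hz
      exact hw (hz ▸ zero_mem _)
    · exact hw0 e
  · rw [e]
    refine P.mul_mem_nonunits (mul_mem (P.aeval_mem hx c) ?_) hw'
    exact sub_mem (P.aeval_mem hx a) (mul_mem (P.aeval_mem hx b) (h.y_mem P hx))

end IsHyperelliptic

end Origami

namespace Origami

/-! ### Reversed polynomials and the chart at infinity -/

section Polynomials

variable {K : Type*} [Field K]

lemma aeval_inv_reflect_mul_pow {L : Type*} [Field L] [Algebra K L] {x : L} (hx : x ≠ 0) {N : ℕ}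
    {p : K[X]} (hp : p.natDegree ≤ N) : aeval x⁻¹ (reflect N p) * x ^ N = aeval x p := by
  let := invertibleOfNonzero hx
  simpa [aeval_def] using eval₂_reflect_mul_pow (algebraMap K L) x N p hp

lemma aeval_eq_aeval_inv_reflect {L : Type*} [Field L] [Algebra K L] {x : L} (hx : x ≠ 0) {N : ℕ}
    {p : K[X]} (hp : p.natDegree ≤ N) : aeval x (reflect N p) = aeval x⁻¹ p * x ^ N := by
  have hN : (reflect N p).natDegree ≤ N := natDegree_reflect_le.trans (by simp [hp])
  rw [← aeval_inv_reflect_mul_pow hx hN, reflect_reflect]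

lemma reverse_reverse_of_coeff_zero_ne {p : K[X]} (hp : p.coeff 0 ≠ 0) :
    p.reverse.reverse = p := by
  have h : p.reverse.natDegree = p.natDegree := by
    rw [reverse_natDegree, natTrailingDegree_eq_zero.mpr (Or.inr hp), Nat.sub_zero]
  rw [reverse, h, reverse, reflect_reflect]

/-- The constant term of the reverse is the leading coefficient of p, so X occurs only once. Any
other square factor is reversed to a square factor of p. -/
lemma squarefree_X_mul_reverse {p : K[X]} (hp : Squarefree p) : Squarefree (X * p.reverse) := by
  have hp0 : p ≠ 0 := hp.ne_zero
  intro d hd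
  have hX : ¬ X ∣ p.reverse := by
    rw [X_dvd_iff, coeff_zero_reverse, leadingCoeff_eq_zero]
    exact hp0
  have hXd : ¬ X ∣ d := fun h => hX <| by
    have := (mul_dvd_mul h h).trans hd
    rwa [mul_dvd_mul_iff_left X_ne_zero] at this
  have hc : IsCoprime d X := (irreducible_X.coprime_iff_not_dvd.mpr hXd).symm
  have hd' : d * d ∣ p.reverse := (hc.mul_left hc).dvd_of_dvd_mul_left hd
  have hd0 : d.coeff 0 ≠ 0 := fun h => hXd (X_dvd_iff.mpr h)
  -- Reversal forgets powers of X; it is an involution only on the cofactor q.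
  obtain ⟨m, q, hq, hpq⟩ : ∃ (m : ℕ) (q : K[X]), q.coeff 0 ≠ 0 ∧ p = X ^ m * q := by
    obtain ⟨q, hq, hq'⟩ := exists_eq_pow_rootMultiplicity_mul_and_not_dvd p hp0 0
    refine ⟨rootMultiplicity 0 p, q, ?_, by simpa using hq⟩
    rwa [map_zero, sub_zero, X_dvd_iff] at hq'
  have hdq : d.reverse * d.reverse ∣ p := by
    rw [hpq, reverse_X_pow_mul] at hd'
    obtain ⟨e, he⟩ := hd'
    refine Dvd.dvd.trans ⟨e.reverse, ?_⟩ (hpq ▸ dvd_mul_left q _)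
    rw [← reverse_mul_of_domain, ← reverse_mul_of_domain, ← he,
      reverse_reverse_of_coeff_zero_ne hq]
  have hu := natDegree_eq_zero_of_isUnit (hp _ hdq)
  rw [reverse_natDegree, natTrailingDegree_eq_zero.mpr (Or.inr hd0), Nat.sub_zero] at hu
  rw [eq_C_of_natDegree_eq_zero hu, isUnit_C]
  exact isUnit_iff_ne_zero.mpr hd0

end Polynomials

namespace IsHyperelliptic

universe u

variable {K L : Type*} [Field K] [Field L] [Algebra K L] {x y : L} {F : K[X]}

/-- The coordinates `1 / x` and `y / x ^ (g + 1)` at infinity. -/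
lemma atInfinity [CharZero K] (h : IsHyperelliptic x y F) {g : ℕ} (hF : F.natDegree = 2 * g + 1) :
    IsHyperelliptic x⁻¹ (y / x ^ (g + 1)) (X * F.reverse) where
  sq := by
    have hx := h.x_ne_zero
    have e := aeval_inv_reflect_mul_pow hx hF.le
    rw [← hF, ← reverse, hF, ← h.sq] at e
    rw [div_pow, ← e, map_mul, aeval_X]
    generalize aeval x⁻¹ F.reverse = r
    rw [div_eq_iff (pow_ne_zero _ (pow_ne_zero _ hx))]
    field_simp
    ring
  separable := PerfectField.separable_iff_squarefree.mpr
    (squarefree_X_mul_reverse h.separable.squarefree)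
  gen z := by
    have hx := h.x_ne_zero
    obtain ⟨a, b, c, hc, hz⟩ := h.gen z
    -- Dividing by x^N turns a, b, c into polynomials in 1/x; the factor X^(g+1) accounts for y =
    -- x^(g+1) v.
    obtain ⟨N, ha, hb, hc'⟩ : ∃ N, a.natDegree ≤ N ∧ b.natDegree ≤ N ∧ c.natDegree ≤ N :=
      ⟨a.natDegree + b.natDegree + c.natDegree, by omega, by omega, by omega⟩
    refine ⟨X ^ (g + 1) * reflect N a, reflect N b, X ^ (g + 1) * reflect N c,
      mul_ne_zero (pow_ne_zero _ X_ne_zero) (by rwa [Ne, reflect_eq_zero_iff]), ?_⟩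
    rw [← aeval_inv_reflect_mul_pow hx ha, ← aeval_inv_reflect_mul_pow hx hb,
      ← aeval_inv_reflect_mul_pow hx hc'] at hz
    simp only [map_mul, map_pow, aeval_X, inv_pow]
    apply mul_right_cancel₀ (pow_ne_zero N hx)
    generalize aeval x⁻¹ (reflect N a) = a' at *
    generalize aeval x⁻¹ (reflect N b) = b' at *
    generalize aeval x⁻¹ (reflect N c) = c' at *
    field_simp
    refine mul_right_cancel₀ (pow_ne_zero N hx) ?_
    linear_combination hz
  indep a b hab := by
    have hx := h.x_ne_zero
    obtain ⟨N, ha, hb⟩ : ∃ N, a.natDegree ≤ N ∧ b.natDegree ≤ N :=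
      ⟨a.natDegree + b.natDegree, by omega, by omega⟩
    have := h.indep (X ^ (g + 1) * reflect N a) (reflect N b) (by
      rw [map_mul, map_pow, aeval_X, aeval_eq_aeval_inv_reflect hx ha,
        aeval_eq_aeval_inv_reflect hx hb]
      have e : aeval x⁻¹ b * x ^ N * y = aeval x⁻¹ b * (y / x ^ (g + 1)) * x ^ N * x ^ (g + 1) := by
        field_simp
      rw [e]
      linear_combination x ^ N * x ^ (g + 1) * hab)
    refine ⟨?_, by simpa using this.2⟩
    have h1 := this.1
    rw [mul_eq_zero, reflect_eq_zero_iff] at h1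
    exact h1.resolve_left (pow_ne_zero _ X_ne_zero)

/-! ### Derivations and differentials of the function field -/

section Derivations

variable (h : IsHyperelliptic x y F)
include h

lemma derivation_y [CharZero K] {V : Type*} [AddCommGroup V] [Module K V] [Module L V]
    (D : Derivation K L V) : (2 * y) • D y = aeval x (derivative F) • D x := by
  have e := congrArg D h.sq
  rw [D.leibniz_pow, D.map_aeval] at e
  rw [← e, ← Nat.cast_smul_eq_nsmul L, smul_smul]
  simp

/-- Every derivation of `L` is a multiple of `d / dx`. -/
lemma derivation_mem_span [CharZero K] {V : Type*} [AddCommGroup V] [Module K V] [Module L V]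
    (D : Derivation K L V) (z : L) : ∃ w : L, D z = w • D x := by
  have hL : CharZero L := charZero_of_injective_algebraMap (algebraMap K L).injective
  have hy : (2 * y) ≠ 0 := mul_ne_zero two_ne_zero h.y_ne_zero
  have ey : D y = ((2 * y)⁻¹ * aeval x (derivative F)) • D x := by
    rw [mul_smul, ← h.derivation_y, smul_smul, inv_mul_cancel₀ hy, one_smul]
  obtain ⟨a, b, c, hc, hz⟩ := h.gen z
  have hc := h.aeval_ne_zero hc
  have e := congrArg D hz
  rw [D.leibniz, map_add, D.leibniz, D.map_aeval, D.map_aeval, D.map_aeval, ey] at e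
  refine ⟨(aeval x c)⁻¹ * (aeval x (derivative a) + aeval x b * ((2 * y)⁻¹ *
    aeval x (derivative F)) + y * aeval x (derivative b) - z * aeval x (derivative c)), ?_⟩
  have e' : aeval x c • D z = (aeval x (derivative a) + aeval x b * ((2 * y)⁻¹ *
    aeval x (derivative F)) + y * aeval x (derivative b) - z * aeval x (derivative c)) • D x := by
    rw [sub_smul, eq_sub_iff_add_eq, mul_smul, e]
    module
  rw [mul_smul, ← e', smul_smul, inv_mul_cancel₀ hc, one_smul]

/-- The space of differentials is spanned by dx over L, so a linear form that is nonzero on dx is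
injective. -/
lemma liftKaehlerDifferential_injective [CharZero K] {D : Derivation K L L} (hD : D x ≠ 0) :
    Function.Injective D.liftKaehlerDifferential := by
  rw [injective_iff_map_eq_zero]
  have hspan : ∀ ω : Ω[L⁄K], ∃ w : L, ω = w • KaehlerDifferential.D K L x := by
    intro ω
    have hω : ω ∈ Submodule.span L (Set.range (KaehlerDifferential.D K L)) := by
      rw [KaehlerDifferential.span_range_derivation]; trivial
    suffices hω' : ω ∈ Submodule.span L {KaehlerDifferential.D K L x} by
      obtain ⟨w, hw⟩ := Submodule.mem_span_singleton.mp hω'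
      exact ⟨w, hw.symm⟩
    refine Submodule.span_le.mpr ?_ hω
    rintro _ ⟨z, rfl⟩
    obtain ⟨w, hw⟩ := h.derivation_mem_span (KaehlerDifferential.D K L) z
    exact Submodule.mem_span_singleton.mpr ⟨w, hw.symm⟩
  intro ω hω
  obtain ⟨w, rfl⟩ := hspan ω
  rw [map_smul, Derivation.liftKaehlerDifferential_comp_D, smul_eq_mul, mul_eq_zero] at hω
  rw [hω.resolve_right hD, zero_smul]

lemma adjoin_eq_top : IntermediateField.adjoin K {x, y} = ⊤ := by
  rw [eq_top_iff]
  intro z _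
  obtain ⟨a, b, c, hc, hz⟩ := h.gen z
  have hc := h.aeval_ne_zero hc
  have hmem : ∀ p : K[X], aeval x p ∈ IntermediateField.adjoin K {x, y} := fun p => by
    have hx : x ∈ IntermediateField.adjoin K {x, y} :=
      IntermediateField.subset_adjoin _ _ (by simp)
    rw [aeval_eq_sum_range]
    exact sum_mem fun i _ => IntermediateField.smul_mem _ (pow_mem hx i)
  have hy : y ∈ IntermediateField.adjoin K {x, y} := IntermediateField.subset_adjoin _ _ (by simp)
  have hz' : z = (aeval x a + aeval x b * y) / aeval x c := by
    rw [eq_div_iff hc, mul_comm, hz]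
  rw [hz']
  exact div_mem (add_mem (hmem a) (mul_mem (hmem b) hy)) (hmem c)

/-- The coordinate function `x` is not algebraic. -/
lemma transcendental : Transcendental K x := by
  rintro ⟨p, hp, hp'⟩
  exact h.aeval_ne_zero hp hp'

/-- There is a derivation dual to `dx / y`. -/
lemma exists_derivation [CharZero K] : ∃ D : Derivation K L L, D x = y := by
  have hfg : Algebra.EssFiniteType K L := by
    rw [← IntermediateField.fg_top_iff, ← h.adjoin_eq_top]
    classical exact ⟨{x, y}, by simp⟩
  -- If dx = 0, all differentials vanish, so L is unramified and therefore algebraic over K,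
  -- contradicting the transcendence of x.
  have hdx : KaehlerDifferential.D K L x ≠ 0 := by
    intro h0
    have hsub : Subsingleton Ω[L⁄K] := by
      refine subsingleton_of_forall_eq 0 fun ω => ?_
      have hω : ω ∈ Submodule.span L (Set.range (KaehlerDifferential.D K L)) := by
        rw [KaehlerDifferential.span_range_derivation]; trivial
      rw [← Submodule.mem_bot L]
      refine Submodule.span_le.mpr ?_ hω
      rintro _ ⟨z, rfl⟩
      obtain ⟨w, hw⟩ := h.derivation_mem_span (KaehlerDifferential.D K L) z
      simp [hw, h0]
    have hu : Algebra.FormallyUnramified K L := ⟨hsub⟩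
    have hs := (Algebra.FormallyUnramified.iff_isSeparable K L).mp hu
    exact h.transcendental (Algebra.IsSeparable.isIntegral K x).isAlgebraic
  obtain ⟨φ, hφ⟩ := Module.Projective.exists_dual_ne_zero L hdx
  refine ⟨(y / φ (KaehlerDifferential.D K L x)) • φ.compDer (KaehlerDifferential.D K L), ?_⟩
  simp [hφ]

end Derivations

/-! ### Regularity of differentials in one chart -/

section Regular

variable [CharZero K] (h : IsHyperelliptic x y F) {D : Derivation K L L} (hD : D x = y)
  (P : Point K L)
include h hD

lemma derivation_y_eq : D y = aeval x (C 2⁻¹ * derivative F) := by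
  have hL : CharZero L := charZero_of_injective_algebraMap (algebraMap K L).injective
  have e := h.derivation_y D
  rw [hD, smul_eq_mul, smul_eq_mul] at e
  have h2 : aeval x (C (2⁻¹ : K)) = 2⁻¹ := by simp [map_ofNat]
  rw [map_mul, h2]
  apply mul_left_cancel₀ (mul_ne_zero two_ne_zero h.y_ne_zero)
  rw [e]
  field_simp

/-- D preserves K[x, y], since D x = y and D y = F'(x)/2; the quotient rule extends this to the
localization. -/
lemma derivation_mem (hx : x ∈ P.ring) {z : L} (hz : z ∈ P.ring) : D z ∈ P.ring := by
  have hy := h.y_mem P hx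
  have key : ∀ p q : K[X], D (aeval x p + aeval x q * y) ∈ P.ring := fun p q => by
    rw [map_add, D.leibniz, D.map_aeval, D.map_aeval, hD, h.derivation_y_eq hD]
    simp only [smul_eq_mul]
    exact add_mem (mul_mem (P.aeval_mem hx _) hy) (add_mem
      (mul_mem (P.aeval_mem hx _) (P.aeval_mem hx _))
      (mul_mem hy (mul_mem (P.aeval_mem hx _) hy)))
  obtain ⟨p, q, r, s, h1, h2⟩ := h.exists_mul_eq P hx hz
  have e := congrArg D h2
  rw [D.leibniz, smul_eq_mul, smul_eq_mul, ← eq_sub_iff_add_eq] at e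
  refine P.mem_of_mul_mem ?_ h1
  rw [e]
  exact sub_mem (key r s) (mul_mem hz (key p q))

/-- The differential `dx / y` is a combination of `dx` and `dy`. -/
lemma exists_combination : ∃ a b : K[X], aeval x a * y * D x + aeval x b * D y = 1 := by
  obtain ⟨a, b, hab⟩ := h.separable
  refine ⟨a, 2 * b, ?_⟩
  have h2 : aeval x (C (2⁻¹ : K)) = 2⁻¹ := by simp [map_ofNat]
  have hL : CharZero L := charZero_of_injective_algebraMap (algebraMap K L).injective
  have e := congrArg (aeval x) hab
  rw [hD, h.derivation_y_eq hD]
  simp only [map_add, map_mul, map_one, ← h.sq, map_ofNat] at e ⊢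
  rw [h2, ← e]
  field_simp

/-- dx/y generates the regular differentials at P: D sends the local ring to itself, and
`exists_combination` writes dx/y through dx and dy with regular coefficients. -/
lemma isRegularAt_iff (hx : x ∈ P.ring) (ω : Ω[L⁄K]) :
    P.IsRegularAt ω ↔ D.liftKaehlerDifferential ω ∈ P.ring := by
  constructor
  · intro hω
    refine Submodule.span_induction (p := fun ω _ => D.liftKaehlerDifferential ω ∈ P.ring)
      ?_ ?_ ?_ ?_ hω
    · rintro _ ⟨v, rfl⟩
      rw [Derivation.liftKaehlerDifferential_comp_D]
      exact h.derivation_mem hD P hx v.2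
    · rw [map_zero]; exact zero_mem _
    · intro _ _ _ _ h1 h2
      rw [map_add]; exact add_mem h1 h2
    · intro c ω _ hω'
      have : c • ω = (c : L) • ω := rfl
      rw [this, map_smul]
      exact mul_mem c.2 hω'
  · intro hω
    obtain ⟨a, b, hab⟩ := h.exists_combination hD
    have hD0 : D x ≠ 0 := hD ▸ h.y_ne_zero
    have hy := h.y_mem P hx
    set z := D.liftKaehlerDifferential ω with hz
    have e : ω = (⟨z * (aeval x a * y), mul_mem hω (mul_mem (P.aeval_mem hx _) hy)⟩ : P.ring) •
        KaehlerDifferential.D K L x + (⟨z * aeval x b, mul_mem hω (P.aeval_mem hx _)⟩ : P.ring) •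
        KaehlerDifferential.D K L y := by
      apply h.liftKaehlerDifferential_injective hD0
      change _ = D.liftKaehlerDifferential ((z * (aeval x a * y)) • KaehlerDifferential.D K L x +
        (z * aeval x b) • KaehlerDifferential.D K L y)
      simp only [map_add, map_smul, Derivation.liftKaehlerDifferential_comp_D, smul_eq_mul]
      rw [← hz]
      linear_combination -z * hab
    rw [Point.IsRegularAt, e]
    exact add_mem (Submodule.smul_mem _ _ (Submodule.subset_span ⟨⟨x, hx⟩, rfl⟩))
      (Submodule.smul_mem _ _ (Submodule.subset_span ⟨⟨y, hy⟩, rfl⟩))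

/-- A derivation with `D x = y` does not map the maximal ideal of the local ring to itself. -/
lemma exists_derivation_notMem_nonunits (hx : x ∈ P.ring) :
    ∃ z ∈ P.ring.nonunits, D z ∉ P.ring.nonunits := by
  by_contra! hm
  have hy := h.y_mem P hx
  classical
  have hDx : D x ∈ P.ring.nonunits := by
    -- The residue field may exceed K, so a polynomial p of least degree with p(x) vanishing at P
    -- replaces x - a. By minimality p'(x) does not vanish at P.
    have hex : ∃ n : ℕ, ∃ p : K[X], p ≠ 0 ∧ aeval x p ∈ P.ring.nonunits ∧ p.natDegree = n := by
      obtain ⟨p, h1, h2⟩ := h.exists_aeval_mem_nonunits P hx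
      exact ⟨_, p, h1, h2, rfl⟩
    obtain ⟨p, hp, hpm, hpn⟩ := Nat.find_spec hex
    have hp0 : p.natDegree ≠ 0 := by
      intro h0
      rw [eq_C_of_natDegree_eq_zero h0, aeval_C] at hpm
      refine P.algebraMap_notMem_nonunits (fun hc => hp ?_) hpm
      rw [eq_C_of_natDegree_eq_zero h0, hc, map_zero]
    have hp' : aeval x (derivative p) ∉ P.ring.nonunits := fun hmem =>
      Nat.find_min hex (m := (derivative p).natDegree)
        (hpn ▸ natDegree_derivative_lt hp0)
        ⟨_, fun h0 => hp0 (derivative_eq_zero.mp h0), hmem, rfl⟩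
    have := hm _ hpm
    rw [D.map_aeval, smul_eq_mul] at this
    exact P.mem_nonunits_of_mul_mem this hp'
  have hDy : D y ∈ P.ring.nonunits := by
    by_cases hym : y ∈ P.ring.nonunits
    · exact hm _ hym
    · have e := h.derivation_y D
      rw [smul_eq_mul, smul_eq_mul] at e
      have h2 : (2 : L) * y ∉ P.ring.nonunits := fun h2 => by
        refine hym (P.mem_nonunits_of_mul_mem h2 ?_)
        have := P.algebraMap_notMem_nonunits (c := 2) two_ne_zero
        rwa [map_ofNat] at this
      exact P.mem_nonunits_of_mul_mem (e ▸ P.mul_mem_nonunits (P.aeval_mem hx _) hDx) h2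
  obtain ⟨a, b, hab⟩ := h.exists_combination hD
  refine P.one_notMem_nonunits ?_
  rw [← hab]
  exact add_mem (P.mul_mem_nonunits (mul_mem (P.aeval_mem hx _) hy) hDx)
    (P.mul_mem_nonunits (P.aeval_mem hx _) hDy)

end Regular

/-! ### Global regular differentials and the genus -/

lemma smul_derivation_inv (h : IsHyperelliptic x y F) {D : Derivation K L L} (hD : D x = y) {g : ℕ}
    (hg : 1 ≤ g) : (-(x ^ (g - 1))⁻¹ • D) x⁻¹ = y / x ^ (g + 1) := by
  have hx := h.x_ne_zero
  obtain ⟨g, rfl⟩ := Nat.exists_eq_add_of_le' hg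
  rw [Derivation.smul_apply, D.leibniz_inv, hD]
  simp only [smul_eq_mul, Nat.add_sub_cancel]
  field_simp
  ring

lemma liftKaehlerDifferential_smul (c : L) (D : Derivation K L L) (ω : Ω[L⁄K]) :
    (c • D).liftKaehlerDifferential ω = c * D.liftKaehlerDifferential ω := by
  have : (c • D).liftKaehlerDifferential = c • D.liftKaehlerDifferential :=
    Derivation.liftKaehlerDifferential_unique _ _ (by ext; simp)
  rw [this, LinearMap.smul_apply, smul_eq_mul]

/-- The regular differentials are the `p(x) dx / y` with `p` of degree less than `g`. -/
lemma mem_regularDifferentials_iff [CharZero K] (h : IsHyperelliptic x y F)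
    {D : Derivation K L L} (hD : D x = y) {g : ℕ} (hg : 1 ≤ g) (hF : F.natDegree = 2 * g + 1)
    (ω : Ω[L⁄K]) : ω ∈ regularDifferentials K L ↔
      ∃ p ∈ degreeLT K g, aeval x p = D.liftKaehlerDifferential ω := by
  have hx0 := h.x_ne_zero
  have hinf := h.atInfinity hF
  have hDinf := h.smul_derivation_inv hD hg
  set z := D.liftKaehlerDifferential ω with hz
  have hreg : ω ∈ regularDifferentials K L ↔ ∀ P : Point K L, (x ∈ P.ring → z ∈ P.ring) ∧
      (x⁻¹ ∈ P.ring → (x ^ (g - 1))⁻¹ * z ∈ P.ring) := by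
    -- At infinity du/v = -x^(g-1) dx/y, so there the function to be tested is z/x^(g-1) up to sign.
    have hz' : (-(x ^ (g - 1))⁻¹ • D).liftKaehlerDifferential ω = -((x ^ (g - 1))⁻¹ * z) := by
      rw [liftKaehlerDifferential_smul, neg_mul]
    refine forall_congr' fun P => ?_
    have h1 := h.isRegularAt_iff hD P (ω := ω)
    have h2 := hinf.isRegularAt_iff hDinf P (ω := ω)
    rw [hz', neg_mem_iff] at h2
    constructor
    · exact fun hω => ⟨fun hx => (h1 hx).mp hω, fun hx => (h2 hx).mp hω⟩
    · rintro ⟨h3, h4⟩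
      rcases P.ring.mem_or_inv_mem x with hx | hx
      · exact (h1 hx).mpr (h3 hx)
      · exact (h2 hx).mpr (h4 hx)
  rw [hreg]
  constructor
  · intro hP
    obtain ⟨a, b, hab⟩ := h.exists_eq_of_forall_mem fun P => (hP P).1
    obtain ⟨c, d, hcd⟩ := hinf.exists_eq_of_forall_mem fun P => (hP P).2
    obtain ⟨N, hc, hd⟩ : ∃ N, c.natDegree ≤ N ∧ d.natDegree ≤ N :=
      ⟨c.natDegree + d.natDegree, by omega, by omega⟩
    have hc' := aeval_eq_aeval_inv_reflect hx0 hc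
    have hd' := aeval_eq_aeval_inv_reflect hx0 hd
    have hcN : (reflect N c).natDegree ≤ N := natDegree_reflect_le.trans (by simp [hc])
    have hdN : (reflect N d).natDegree ≤ N := natDegree_reflect_le.trans (by simp [hd])
    -- The two expansions a + b y and x^(g-1) (c(1/x) + d(1/x) y/x^(g+1)) of z agree after
    -- multiplication by x^(N+g+1). Comparing degrees yields b = 0 and deg a < g.
    have hind := h.indep (X ^ (N + g + 1) * a - X ^ (2 * g) * reflect N c)
      (X ^ (N + g + 1) * b - X ^ (g - 1) * reflect N d) (by
        simp only [map_sub, map_mul, map_pow, aeval_X]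
        rw [hc', hd']
        obtain ⟨g, rfl⟩ := Nat.exists_eq_add_of_le' hg
        rw [hab] at hcd
        simp only [Nat.add_sub_cancel] at hcd ⊢
        generalize aeval x⁻¹ c = c' at *
        generalize aeval x⁻¹ d = d' at *
        field_simp at hcd
        linear_combination x ^ N * hcd)
    obtain ⟨ea, eb⟩ := hind
    rw [sub_eq_zero] at ea eb
    have hb0 : b = 0 := by
      by_contra hb
      have e := congrArg natDegree eb
      have hd0 : reflect N d ≠ 0 := by
        intro h0
        rw [h0, mul_zero] at eb
        exact mul_ne_zero (pow_ne_zero _ X_ne_zero) hb eb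
      rw [natDegree_mul (pow_ne_zero _ X_ne_zero) hb, natDegree_mul (pow_ne_zero _ X_ne_zero) hd0,
        natDegree_X_pow, natDegree_X_pow] at e
      omega
    refine ⟨a, ?_, by rw [hab, hb0]; simp⟩
    rw [mem_degreeLT]
    by_cases ha : a = 0
    · rw [ha, degree_zero]; exact WithBot.bot_lt_coe _
    · have e := congrArg natDegree ea
      have hc0 : reflect N c ≠ 0 := by
        intro h0
        rw [h0, mul_zero] at ea
        exact mul_ne_zero (pow_ne_zero _ X_ne_zero) ha ea
      rw [natDegree_mul (pow_ne_zero _ X_ne_zero) ha, natDegree_mul (pow_ne_zero _ X_ne_zero) hc0,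
        natDegree_X_pow, natDegree_X_pow] at e
      rw [← natDegree_lt_iff_degree_lt ha]
      omega
  · rintro ⟨p, hp, hpz⟩ P
    have hpg : p.natDegree ≤ g - 1 := by
      rw [mem_degreeLT] at hp
      by_cases h0 : p = 0
      · simp [h0]
      · have := (natDegree_lt_iff_degree_lt h0).mpr hp
        omega
    refine ⟨fun hx => hpz ▸ P.aeval_mem hx p, fun hx => ?_⟩
    rw [← hpz, ← aeval_inv_reflect_mul_pow hx0 hpg, mul_comm, mul_assoc,
      mul_inv_cancel₀ (pow_ne_zero _ hx0), mul_one]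
    exact P.aeval_mem hx _

/-- The genus of a hyperelliptic curve `y² = F(x)` with `F` of degree `2 g + 1`. -/
theorem genus_eq [CharZero K] (h : IsHyperelliptic x y F) {g : ℕ} (hg : 1 ≤ g)
    (hF : F.natDegree = 2 * g + 1) : genus K L = g := by
  obtain ⟨D, hD⟩ := h.exists_derivation
  have hD0 : D x ≠ 0 := hD ▸ h.y_ne_zero
  have hφ := h.liftKaehlerDifferential_injective hD0
  set φ : Ω[L⁄K] →ₗ[K] L := D.liftKaehlerDifferential.restrictScalars K with hφd
  have hmap : (regularDifferentials K L).map φ = (degreeLT K g).map (aeval x).toLinearMap := by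
    ext z
    simp only [Submodule.mem_map]
    constructor
    · rintro ⟨ω, hω, rfl⟩
      exact (h.mem_regularDifferentials_iff hD hg hF ω).mp hω
    · rintro ⟨p, hp, rfl⟩
      refine ⟨(aeval x p / D x) • KaehlerDifferential.D K L x, ?_, ?_⟩
      · rw [h.mem_regularDifferentials_iff hD hg hF]
        exact ⟨p, hp, by simp [hD0]⟩
      · simp [hφd, hD0]
  rw [genus, (Submodule.equivMapOfInjective φ hφ _).finrank_eq, hmap,
    ← (Submodule.equivMapOfInjective (aeval x).toLinearMap
      (transcendental_iff_injective.mp h.transcendental) (degreeLT K g)).finrank_eq,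
    (degreeLTEquiv K g).finrank_eq, Module.finrank_fin_fun]

end IsHyperelliptic

end Origami

namespace Origami

/-! ### The polynomials j and o: identities and separability -/

section Sums

lemma map_jSum {R S : Type*} [CommRing R] [CommRing S] (f : R →+* S) (g : ℕ) (x : R) :
    f (jSum g x) = jSum g (f x) := by
  simp [jSum]

lemma map_oddSum {R S : Type*} [CommRing R] [CommRing S] (f : R →+* S) (g : ℕ) (x : R) :
    f (oddSum g x) = oddSum g (f x) := by
  simp [oddSum]

lemma aeval_jSum {K A : Type*} [Field K] [CommRing A] [Algebra K A] (g : ℕ) (x : A) :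
    aeval x (jSum g (X : K[X])) = jSum g x := by
  simpa using map_jSum ((aeval x : K[X] →ₐ[K] A) : K[X] →+* A) g X

lemma aeval_oddSum {K A : Type*} [Field K] [CommRing A] [Algebra K A] (g : ℕ) (x : A) :
    aeval x (oddSum g (X : K[X])) = oddSum g x := by
  simpa using map_oddSum ((aeval x : K[X] →ₐ[K] A) : K[X] →+* A) g X

lemma sum_range_two_mul {M : Type*} [AddCommMonoid M] (f : ℕ → M) (g : ℕ) :
    ∑ m ∈ Finset.range (2 * g), f m = ∑ i ∈ Finset.range g, (f (2 * i) + f (2 * i + 1)) := by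
  induction g with
  | zero => simp
  | succ g ih =>
    rw [Finset.sum_range_succ, ← ih, mul_add, Finset.sum_range_succ, Finset.sum_range_succ,
      add_assoc]

/-- The even and odd parts of `(1 + s)^{2g-1}`. -/
lemma one_add_pow_eq {R : Type*} [CommRing R] {g : ℕ} (hg : 1 ≤ g) (s : R) :
    (1 + s) ^ (2 * g - 1) = jSum g (s ^ 2 - 1) + s * oddSum g (s ^ 2 - 1) := by
  rw [add_comm, add_pow, Nat.sub_add_cancel (by omega), sum_range_two_mul, jSum, oddSum,
    Finset.mul_sum, ← Finset.sum_add_distrib]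
  refine Finset.sum_congr rfl fun i _ => ?_
  simp only [one_pow, mul_one, sub_add_cancel]
  ring

end Sums

section Identities

variable {K : Type*} [Field K]

/-- Identities in x may thus be checked after x = s²-1, where j and o are expressed through (1±s)^n.
-/
lemma comp_sq_sub_one_injective : Function.Injective fun p : K[X] => p.comp (X ^ 2 - 1) := by
  have hq : ((X : K[X]) ^ 2 - 1).natDegree = 2 := by
    simpa using natDegree_X_pow_sub_C (R := K) (n := 2) (r := 1)
  have h0 : ∀ p : K[X], p.comp (X ^ 2 - 1) = 0 → p = 0 := by
    intro p hp
    rw [comp_eq_zero_iff] at hp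
    refine hp.resolve_right fun h => ?_
    rw [h.2, natDegree_C] at hq
    omega
  intro p q hpq
  exact sub_eq_zero.mp (h0 _ (by rw [sub_comp, sub_eq_zero]; exact hpq))

lemma jSum_comp (g : ℕ) (q : K[X]) : (jSum g (X : K[X])).comp q = jSum g q := by
  simpa using map_jSum (compRingHom q) g X

lemma oddSum_comp (g : ℕ) (q : K[X]) : (oddSum g (X : K[X])).comp q = oddSum g q := by
  simpa using map_oddSum (compRingHom q) g X

lemma one_add_X_pow {g : ℕ} (hg : 1 ≤ g) : (1 + X : K[X]) ^ (2 * g - 1) =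
    (jSum g X).comp (X ^ 2 - 1) + X * (oddSum g X).comp (X ^ 2 - 1) := by
  rw [one_add_pow_eq hg, jSum_comp, oddSum_comp]

lemma one_sub_X_pow {g : ℕ} (hg : 1 ≤ g) : (1 - X : K[X]) ^ (2 * g - 1) =
    (jSum g X).comp (X ^ 2 - 1) - X * (oddSum g X).comp (X ^ 2 - 1) := by
  rw [sub_eq_add_neg, one_add_pow_eq hg, jSum_comp, oddSum_comp, neg_sq]
  ring

lemma jSum_sq_add {g : ℕ} (hg : 1 ≤ g) :
    jSum g (X : K[X]) ^ 2 + X ^ (2 * g - 1) = (X + 1) * oddSum g X ^ 2 := by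
  apply comp_sq_sub_one_injective
  have h1 := one_add_X_pow (K := K) hg
  have h2 := one_sub_X_pow (K := K) hg
  have h3 : (X ^ 2 - 1 : K[X]) ^ (2 * g - 1) =
      -((1 + X : K[X]) ^ (2 * g - 1) * (1 - X : K[X]) ^ (2 * g - 1)) := by
    rw [← mul_pow, ← Odd.neg_pow ⟨g - 1, by omega⟩]
    congr 1; ring
  simp only [add_comp, mul_comp, pow_comp, X_comp, one_comp, h3, h1, h2]
  ring

lemma derivative_jSum [CharZero K] {g : ℕ} (hg : 1 ≤ g) :
    ((2 * g - 1 : ℕ) : K[X]) * jSum g X - 2 * X * derivative (jSum g X) =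
      ((2 * g - 1 : ℕ) : K[X]) * oddSum g X := by
  apply comp_sq_sub_one_injective
  have h1 := one_add_X_pow (K := K) hg
  have h2 := one_sub_X_pow (K := K) hg
  have d1 := congrArg derivative h1
  have d2 := congrArg derivative h2
  have e1 : (1 + X : K[X]) ^ (2 * g - 1) = (1 + X) ^ (2 * g - 1 - 1) * (1 + X) := by
    rw [← pow_succ]; congr 1; omega
  have e2 : (1 - X : K[X]) ^ (2 * g - 1) = (1 - X) ^ (2 * g - 1 - 1) * (1 - X) := by
    rw [← pow_succ]; congr 1; omega
  rw [e1] at h1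
  rw [e2] at h2
  simp only [derivative_pow, derivative_add, derivative_sub, derivative_mul, derivative_comp,
    derivative_one, derivative_X, zero_add, sub_zero, zero_sub] at d1 d2
  simp only [sub_comp, mul_comp, X_comp, natCast_comp, ofNat_comp] at d1 d2 ⊢
  generalize (1 + X : K[X]) ^ (2 * g - 1 - 1) = A at *
  generalize (1 - X : K[X]) ^ (2 * g - 1 - 1) = B at *
  generalize (2 * g - 1 : ℕ) = n at *
  simp only [C_eq_natCast] at d1 d2
  push_cast at d1 d2
  -- The sum of the two derivatives is n(A - B) = 4s j', where A and B are the powers of 1±s with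
  -- exponent n-1. Multiplication by 1-s² restores the exponent n, and both sides carry the factor
  -- 2s.
  apply mul_left_cancel₀ (mul_ne_zero (two_ne_zero (α := K[X])) X_ne_zero)
  linear_combination -(1 - X ^ 2) * (d1 + d2) + (n : K[X]) * (1 - X) * h1
    - (n : K[X]) * (1 + X) * h2

lemma jSum_zero_ne_zero [CharZero K] {g : ℕ} (hg : 1 ≤ g) : jSum g (0 : K) ≠ 0 := by
  have h : jSum g (0 : K) =
      ((∑ i ∈ Finset.range g, (2 * g - 1).choose (2 * i) : ℕ) : K) := by
    simp [jSum]
  rw [h, Nat.cast_ne_zero]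
  have : 0 < ∑ i ∈ Finset.range g, (2 * g - 1).choose (2 * i) :=
    Finset.sum_pos (fun i hi => Nat.choose_pos (by have := Finset.mem_range.mp hi; omega))
      ⟨0, Finset.mem_range.mpr hg⟩
  omega

lemma separable_curvePoly [CharZero K] {g : ℕ} (hg : 1 ≤ g) {t : K} (ht0 : t ≠ 0) (ht1 : t ≠ 1) :
    (curvePoly g t).Separable := by
  rw [Separable, isCoprime_iff_aeval_ne_zero_of_isAlgClosed K (AlgebraicClosure K)]
  intro a
  by_contra! hab
  obtain ⟨h1, h2⟩ := hab
  have hn : (2 * g - 1 : ℕ) ≠ 0 := by omega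
  have hj0 := jSum_zero_ne_zero (K := AlgebraicClosure K) hg
  have i1 := congrArg (aeval a) (jSum_sq_add (K := K) hg)
  have i2 := congrArg (aeval a) (derivative_jSum (K := K) hg)
  have i3 : (X : K[X]) ^ (2 * g - 1) = X ^ (2 * g - 1 - 1) * X := by
    rw [← pow_succ]; congr 1; omega
  have i3 := congrArg (aeval a) i3
  have htK : algebraMap K (AlgebraicClosure K) t ≠ 0 := by simpa using ht0
  have htK1 : algebraMap K (AlgebraicClosure K) t - 1 ≠ 0 := by
    rw [sub_ne_zero]
    intro h
    exact ht1 ((algebraMap K (AlgebraicClosure K)).injective (by simpa using h))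
  simp only [curvePoly, derivative_mul, derivative_X, derivative_one,
    derivative_pow, derivative_C, map_mul, map_add, map_sub, map_pow, map_one, map_natCast,
    map_ofNat, aeval_X, aeval_C, aeval_jSum, aeval_oddSum, map_zero] at h1 h2 i1 i2 i3
  generalize 2 * g - 1 = n at *
  -- If j(a) = 0, either j² + x^n = (x+1) o² or the equation itself forces a^n = 0, although j(0) ≠
  -- 0.
  have hjn : jSum g a = 0 → False := by
    intro hj
    by_cases ha : a = 0
    · exact hj0 (ha ▸ hj)
    · have hh : a ^ n ≠ 0 := pow_ne_zero n ha
      by_cases hk : a + 1 = 0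
      · rw [hj, hk] at i1
        apply hh; linear_combination i1
      · rw [hj] at h1
        refine mul_ne_zero (mul_ne_zero ha hk) hh ?_
        linear_combination h1
  generalize hT : algebraMap K (AlgebraicClosure K) t = T at *
  by_cases ha : a = 0
  · rw [ha, zero_pow hn] at h2
    have : T * jSum g (0 : AlgebraicClosure K) ^ 2 = 0 := by linear_combination h2
    exact mul_ne_zero htK (pow_ne_zero 2 hj0) this
  by_cases hb : a + 1 = 0
  · have e : (T - 1) * jSum g a ^ 2 = 0 := by
      rw [hb] at h2 i1
      have ha1 : a = -1 := by linear_combination hb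
      linear_combination (-1) * h2 - i1 + (a ^ n + T * jSum g a ^ 2) * ha1
    exact hjn (by simpa [htK1] using e)
  have hh : a ^ n + T * jSum g a ^ 2 = 0 := by simpa [ha, hb] using h1
  -- For H = x^n + t j², the derivative identity gives x H' = n H - n t j o, so a double root of H
  -- kills j o. If o vanishes, then H = (t-1) j².
  have e : (n : AlgebraicClosure K) * T * (jSum g a * oddSum g a) = 0 := by
    apply mul_left_cancel₀ hb
    push_cast at h2
    linear_combination -h2 + (n * (a + 1) + (2 * a + 1)) * hh 
      - T * jSum g a * (a + 1) * i2 - n * (a + 1) * i3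
  have e' : jSum g a * oddSum g a = 0 := by
    simpa [htK, hn] using e
  rcases mul_eq_zero.mp e' with e | e
  · exact hjn e
  · have : (T - 1) * jSum g a ^ 2 = 0 := by
      rw [e] at i1
      linear_combination hh - i1
    exact hjn (by simpa [htK1] using this)

lemma natDegree_curvePoly {g : ℕ} (hg : 1 ≤ g) (t : K) :
    (curvePoly g t).natDegree = 2 * g + 1 := by
  have hX1 : ((X : K[X]) + 1).natDegree = 1 := by simpa using natDegree_X_add_C (1 : K)
  have hlt : (C t * jSum g (X : K[X]) ^ 2).natDegree < ((X : K[X]) ^ (2 * g - 1)).natDegree := by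
    have h1 := natDegree_jSum_le (K := K) g
    have h2 : (C t * jSum g (X : K[X]) ^ 2).natDegree ≤ 2 * (g - 1) :=
      (natDegree_C_mul_le _ _).trans (natDegree_pow_le.trans (by omega))
    rw [natDegree_X_pow]
    omega
  have hG : (X ^ (2 * g - 1) + C t * jSum g (X : K[X]) ^ 2).natDegree = 2 * g - 1 := by
    rw [natDegree_add_eq_left_of_natDegree_lt hlt, natDegree_X_pow]
  have hG0 : (X ^ (2 * g - 1) + C t * jSum g (X : K[X]) ^ 2) ≠ 0 := by
    intro h0
    rw [h0, natDegree_zero] at hG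
    omega
  have hX10 : (X : K[X]) + 1 ≠ 0 := by
    intro h0
    rw [h0, natDegree_zero] at hX1
    omega
  rw [curvePoly, natDegree_mul (mul_ne_zero X_ne_zero hX10) hG0,
    natDegree_mul X_ne_zero hX10, hG, hX1, natDegree_X]
  omega

lemma eval_zero_curvePoly (g : ℕ) (t : K) : (curvePoly g t).eval 0 = 0 := by
  simp [curvePoly]

/-- Since j = 1 for g = 1, E_t is the genus one member of the family and shares all lemmas on C_t.
-/
lemma curvePoly_one (t : K) : curvePoly 1 t = X * (X + 1) * (X + C t) := by
  simp [curvePoly, jSum]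

end Identities

/-! ### The function fields of C_t and E_t -/

section FunctionFields

variable {K : Type*} [Field K]

lemma isHyperelliptic_adjoinRoot {p : K[X][X]} {F : K[X]} (hp : p = X ^ 2 - C F)
    [IsDomain (AdjoinRoot p)] (hF : F.Separable) :
    IsHyperelliptic (algebraMap (AdjoinRoot p) (FractionRing (AdjoinRoot p)) (AdjoinRoot.of p X))
      (algebraMap (AdjoinRoot p) (FractionRing (AdjoinRoot p)) (AdjoinRoot.root p)) F := by
  have hmonic : p.Monic := hp ▸ monic_X_pow_sub_C F two_ne_zero
  have hdeg : p.natDegree = 2 := by rw [hp]; exact natDegree_X_pow_sub_C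
  set ι := algebraMap (AdjoinRoot p) (FractionRing (AdjoinRoot p)) with hι
  have hinj : Function.Injective ι := IsFractionRing.injective _ _
  have haeval : ∀ q : K[X], aeval (ι (AdjoinRoot.of p X)) q = ι (AdjoinRoot.of p q) := by
    intro q
    rw [hι, aeval_algebraMap_apply]
    congr 1
    induction q using Polynomial.induction_on' with
    | add a b ha hb => simp only [map_add, ha, hb]
    | monomial n a =>
      rw [aeval_monomial, ← C_mul_X_pow_eq_monomial, map_mul, map_pow]
      rfl
  have hlin : ∀ a b : K[X], ι (AdjoinRoot.of p a) + ι (AdjoinRoot.of p b) * ι (AdjoinRoot.root p) =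
      ι (AdjoinRoot.mk p (C a + C b * X)) := by
    intro a b
    simp
  have hdiv : ∀ q : K[X][X], ∃ a b : K[X], AdjoinRoot.mk p q = AdjoinRoot.mk p (C a + C b * X) := by
    intro q
    have hq : (q %ₘ p).natDegree ≤ 1 := by
      have := natDegree_modByMonic_lt q hmonic (by rintro h; simp [h] at hdeg)
      omega
    obtain ⟨b, a, hab⟩ := exists_eq_X_add_C_of_natDegree_le_one hq
    refine ⟨a, b, ?_⟩
    rw [add_comm, ← hab, AdjoinRoot.mk_eq_mk]
    exact ⟨q /ₘ p, by linear_combination -(modByMonic_add_div q p)⟩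
  have hindep : ∀ a b : K[X], AdjoinRoot.mk p (C a + C b * X) = 0 → a = 0 ∧ b = 0 := by
    intro a b hab
    rw [AdjoinRoot.mk_eq_zero] at hab
    have h0 : C a + C b * X = 0 := by
      refine eq_zero_of_dvd_of_natDegree_lt hab ?_
      rw [hdeg, add_comm]
      exact natDegree_linear_le.trans_lt one_lt_two
    constructor
    · simpa using congrArg (coeff · 0) h0
    · simpa using congrArg (coeff · 1) h0
  have hsq : AdjoinRoot.root p ^ 2 = AdjoinRoot.of p F := by
    have h : AdjoinRoot.mk p (X ^ 2 - C F) = 0 := by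
      rw [AdjoinRoot.mk_eq_zero, hp]
    simpa [sub_eq_zero] using h
  refine ⟨?_, hF, ?_, ?_⟩
  · rw [haeval, ← map_pow, hsq]
  · intro z
    obtain ⟨u, v, hv, rfl⟩ := IsFractionRing.div_surjective (A := AdjoinRoot p) z
    obtain ⟨u, rfl⟩ := AdjoinRoot.mk_surjective u
    obtain ⟨v, rfl⟩ := AdjoinRoot.mk_surjective v
    obtain ⟨a, b, hab⟩ := hdiv u
    obtain ⟨c, d, hcd⟩ := hdiv v
    have hv0 : ι (AdjoinRoot.mk p v) ≠ 0 := by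
      rw [Ne, map_eq_zero_iff _ hinj]
      exact nonZeroDivisors.ne_zero hv
    rw [hab, hcd] at *
    rw [← hlin] at *
    set y := ι (AdjoinRoot.root p)
    have hy : y ^ 2 = ι (AdjoinRoot.of p F) := by rw [← hsq, map_pow]
    have hnorm : (ι (AdjoinRoot.of p c) + ι (AdjoinRoot.of p d) * y) *
        (ι (AdjoinRoot.of p c) - ι (AdjoinRoot.of p d) * y) =
          ι (AdjoinRoot.of p (c ^ 2 - d ^ 2 * F)) := by
      simp only [map_sub, map_mul, map_pow, ← hy]; ring
    -- The conjugate c - d y rationalizes the denominator c + d y.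
    refine ⟨a * c - b * d * F, b * c - a * d, c ^ 2 - d ^ 2 * F, ?_, ?_⟩
    · intro h0
      rw [h0, map_zero, map_zero, mul_eq_zero] at hnorm
      have h1 := hnorm.resolve_left hv0
      have h2 := hindep c (-d) (hinj (by
        rw [← hlin, map_zero, ← h1]; simp only [map_neg]; ring))
      rw [neg_eq_zero] at h2
      apply hv0
      rw [h2.1, h2.2]; simp
    · rw [haeval, haeval, haeval, ← hnorm]
      simp only [map_sub, map_mul, ← hy]
      rw [← hlin]
      field_simp
      ring
  · intro a b hab
    rw [haeval, haeval, hlin] at hab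
    exact hindep a b (hinj (by rw [hab, map_zero]))

lemma isHyperelliptic_C [CharZero K] {g : ℕ} (hg : 1 ≤ g) {t : K} (ht0 : t ≠ 0) (ht1 : t ≠ 1) :
    IsHyperelliptic (xC g t) (yC g t) (curvePoly g t) :=
  isHyperelliptic_adjoinRoot rfl (separable_curvePoly hg ht0 ht1)

lemma curveE_polynomial (t : K) : (curveE t).polynomial = X ^ 2 - C (curvePoly 1 t) := by
  rw [curvePoly_one, WeierstrassCurve.Affine.polynomial]
  simp only [curveE, map_zero, zero_mul, add_zero, map_add, map_one, map_mul, map_pow]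
  ring

lemma isHyperelliptic_E [CharZero K] {t : K} (ht0 : t ≠ 0) (ht1 : t ≠ 1) :
    IsHyperelliptic (xE t) (yE t) (curvePoly 1 t) :=
  isHyperelliptic_adjoinRoot (curveE_polynomial t) (separable_curvePoly le_rfl ht0 ht1)

lemma curveE_isElliptic [CharZero K] {t : K} (ht0 : t ≠ 0) (ht1 : t ≠ 1) :
    (curveE t).IsElliptic := by
  rw [WeierstrassCurve.isElliptic_iff, isUnit_iff_ne_zero]
  have : (curveE t).Δ = 16 * (t * (t - 1)) ^ 2 := by
    simp only [WeierstrassCurve.Δ, WeierstrassCurve.b₂, WeierstrassCurve.b₄, WeierstrassCurve.b₆,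
      WeierstrassCurve.b₈, curveE]
    ring
  rw [this]
  exact mul_ne_zero (by norm_num) (pow_ne_zero 2 (mul_ne_zero ht0 (sub_ne_zero.mpr ht1)))

end FunctionFields

end Origami

namespace Origami

/-! ### Ramification and maps for general function fields -/

section Generic

variable {K L M : Type*} [Field K] [Field L] [Field M] [Algebra K L] [Algebra K M]

namespace CurveMap

variable (f : CurveMap K L M) (P : Point K L)

lemma mem_onPoints_nonunits_iff (v : M) :
    v ∈ (f.onPoints P).ring.nonunits ↔ f.pullback v ∈ P.ring.nonunits := by
  have h : v⁻¹ ∈ (f.onPoints P).ring ↔ (f.pullback v)⁻¹ ∈ P.ring := by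
    rw [← map_inv₀]
    exact ValuationSubring.mem_comap
  rw [ValuationSubring.mem_nonunits_iff_or, ValuationSubring.mem_nonunits_iff_or, h, map_eq_zero]

/-- The maximal ideals are generated by ϖ and y, so the one at f(P) extends to (ε y^n). Were this
inside (y^(n+1)), ε would be divisible by y. -/
lemma ramificationIdx_eq_of_uniformizer {n : ℕ} {ϖ : M} {y ε : L}
    (hϖ : ϖ ∈ (f.onPoints P).ring.nonunits)
    (hQ : ∀ v ∈ (f.onPoints P).ring.nonunits, ∃ w ∈ (f.onPoints P).ring, v = ϖ * w)
    (hy : y ∈ P.ring.nonunits) (hy0 : y ≠ 0)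
    (hP : ∀ v ∈ P.ring.nonunits, ∃ w ∈ P.ring, v = y * w)
    (hε : ε ∈ P.ring) (hε' : ε ∉ P.ring.nonunits) (hf : f.pullback ϖ = ε * y ^ n) :
    f.ramificationIdx P = n := by
  let := (f.localHom P).toAlgebra
  have hval : ∀ v : (f.onPoints P).ring, ((f.localHom P v : P.ring) : L) = f.pullback v :=
    fun v => rfl
  set y' : P.ring := ⟨y, P.mem_of_mem_nonunits hy⟩
  have hmax : IsLocalRing.maximalIdeal P.ring = Ideal.span {y'} := by
    apply le_antisymm
    · intro v hv
      obtain ⟨w, hw, hvw⟩ := hP v (P.ring.coe_mem_nonunits_iff.mpr hv)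
      rw [Ideal.mem_span_singleton]
      exact ⟨⟨w, hw⟩, Subtype.ext hvw⟩
    · rw [Ideal.span_singleton_le_iff_mem, ← ValuationSubring.coe_mem_nonunits_iff]
      exact hy
  refine Ideal.ramificationIdx'_spec ?_ ?_
  · rw [Ideal.map_le_iff_le_comap]
    intro v hv
    obtain ⟨w, hw, hvw⟩ := hQ v ((f.onPoints P).ring.coe_mem_nonunits_iff.mpr hv)
    rw [Ideal.mem_comap, hmax, Ideal.span_singleton_pow, Ideal.mem_span_singleton]
    refine ⟨⟨ε, hε⟩ * f.localHom P ⟨w, hw⟩, Subtype.ext ?_⟩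
    change f.pullback v = y ^ n * (ε * f.pullback w)
    rw [hvw, map_mul, hf]
    ring
  · rw [Ideal.map_le_iff_le_comap]
    intro hle
    have hm : (⟨ϖ, (f.onPoints P).mem_of_mem_nonunits hϖ⟩ : (f.onPoints P).ring) ∈
        IsLocalRing.maximalIdeal (f.onPoints P).ring :=
      (f.onPoints P).ring.coe_mem_nonunits_iff.mp hϖ
    have h1 := hle hm
    rw [Ideal.mem_comap, hmax, Ideal.span_singleton_pow, Ideal.mem_span_singleton] at h1
    obtain ⟨w, hw⟩ := h1
    have h2 : f.pullback ϖ = y ^ (n + 1) * w := congrArg Subtype.val hw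
    apply hε'
    have h3 : ε = w * y := by
      apply mul_right_cancel₀ (pow_ne_zero n hy0)
      rw [← hf, h2]; ring
    rw [h3]
    exact P.mul_mem_nonunits w.2 hy

/-- If a derivation preserving the local ring at `P` is compatible, up to a unit, with a derivation
that does not preserve the maximal ideal at `f(P)`, then `f` is unramified at `P`. -/
lemma ramificationIdx_eq_one {D : Derivation K L L} {D' : Derivation K M M} {e : L}
    (hD : ∀ z ∈ P.ring, D z ∈ P.ring) (he : e ∉ P.ring.nonunits)
    (hDD' : ∀ v : M, D (f.pullback v) = e * f.pullback (D' v))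
    (hD' : ∃ v ∈ (f.onPoints P).ring.nonunits, D' v ∉ (f.onPoints P).ring.nonunits) :
    f.ramificationIdx P = 1 := by
  let := (f.localHom P).toAlgebra
  refine Ideal.ramificationIdx'_spec ?_ ?_
  · rw [Ideal.map_le_iff_le_comap, pow_one]
    intro v hv
    rw [Ideal.mem_comap, ← ValuationSubring.coe_mem_nonunits_iff]
    exact (f.mem_onPoints_nonunits_iff P v).mp ((f.onPoints P).ring.coe_mem_nonunits_iff.mpr hv)
  · rw [Ideal.map_le_iff_le_comap]
    intro hle
    obtain ⟨v, hv, hv'⟩ := hD'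
    apply hv'
    rw [mem_onPoints_nonunits_iff]
    refine P.mem_nonunits_of_mul_mem ?_ he
    rw [← hDD']
    have hm : (⟨v, (f.onPoints P).mem_of_mem_nonunits hv⟩ : (f.onPoints P).ring) ∈
        IsLocalRing.maximalIdeal (f.onPoints P).ring :=
      (f.onPoints P).ring.coe_mem_nonunits_iff.mp hv
    have h1 := hle hm
    rw [Ideal.mem_comap, pow_two] at h1
    -- By the Leibniz rule D maps the square of the maximal ideal into the maximal ideal, whereas
    -- the pullback of v has a derivative outside it.
    have key : ∀ z ∈ IsLocalRing.maximalIdeal P.ring * IsLocalRing.maximalIdeal P.ring,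
        D (z : L) ∈ P.ring.nonunits := by
      intro z hz
      refine Submodule.mul_induction_on hz ?_ ?_
      · intro a ha b hb
        change D ((a : L) * b) ∈ _
        rw [D.leibniz, smul_eq_mul, smul_eq_mul, mul_comm, mul_comm (b : L)]
        exact add_mem
          (P.mul_mem_nonunits (hD b b.2) (P.ring.coe_mem_nonunits_iff.mpr ha))
          (P.mul_mem_nonunits (hD a a.2) (P.ring.coe_mem_nonunits_iff.mpr hb))
      · intro a b ha hb
        change D ((a : L) + b) ∈ _
        rw [map_add]
        exact add_mem ha hb
    exact key _ h1

end CurveMap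

/-- After division by a power of z, an algebraic relation has nonzero constant term, and its value
is then a unit at P. -/
lemma Point.transcendental_of_mem_nonunits (P : Point K L) {z : L} (hz : z ∈ P.ring.nonunits)
    (hz0 : z ≠ 0) : Transcendental K z := by
  rintro ⟨p, hp, hp0⟩
  obtain ⟨q, hq, hq'⟩ := exists_eq_pow_rootMultiplicity_mul_and_not_dvd p hp 0
  rw [map_zero, sub_zero] at hq hq'
  rw [X_dvd_iff, coeff_zero_eq_eval_zero, ← P.aeval_mem_nonunits_iff hz] at hq'
  rw [hq, map_mul, map_pow, aeval_X, mul_eq_zero] at hp0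
  exact hq' (hp0.resolve_left (pow_ne_zero _ hz0) ▸ zero_mem _)

lemma Point.div_sub_mem_nonunits (P : Point K L) {x : L} {a : K}
    (hx : x - algebraMap K L a ∈ P.ring.nonunits) (r s : K[X]) (hs : s.eval a ≠ 0) :
    aeval x r / aeval x s ∈ P.ring ∧
      aeval x r / aeval x s - algebraMap K L (r.eval a / s.eval a) ∈ P.ring.nonunits := by
  have hx' : x ∈ P.ring := by
    have := add_mem (P.mem_of_mem_nonunits hx) (P.algebraMap_mem a)
    rwa [sub_add_cancel] at this
  have hsx : aeval x s ∉ P.ring.nonunits := fun h =>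
    P.algebraMap_notMem_nonunits hs (by simpa using sub_mem h (P.aeval_sub_mem_nonunits hx s))
  have hs0 : aeval x s ≠ 0 := fun h => hsx (h ▸ zero_mem _)
  have hsa : algebraMap K L (s.eval a) ≠ 0 := by simpa using hs
  refine ⟨div_eq_mul_inv (aeval x r) _ ▸ mul_mem (P.aeval_mem hx' r) (P.inv_mem hsx), ?_⟩
  have h := P.aeval_sub_mem_nonunits hx (r * C (s.eval a) - C (r.eval a) * s)
  have e : aeval x r / aeval x s - algebraMap K L (r.eval a / s.eval a) =
      ((aeval x s)⁻¹ * algebraMap K L (s.eval a)⁻¹) *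
        (aeval x (r * C (s.eval a) - C (r.eval a) * s) -
          algebraMap K L ((r * C (s.eval a) - C (r.eval a) * s).eval a)) := by
    simp only [map_sub, map_mul, map_div₀, map_inv₀, aeval_C, eval_sub, eval_mul, eval_C]
    field_simp
    ring
  rw [e]
  exact P.mul_mem_nonunits (mul_mem (P.inv_mem hsx) (P.algebraMap_mem _)) h

/-- Homomorphisms out of the function field of `y² = F(x)`. -/
lemma exists_algHom_adjoinRoot {p : K[X][X]} {F : K[X]} (hp : p = X ^ 2 - C F)
    [IsDomain (AdjoinRoot p)] {x y : L} (hsq : y ^ 2 = aeval x F)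
    (hind : ∀ a b : K[X], aeval x a + aeval x b * y = 0 → a = 0 ∧ b = 0) :
    ∃ φ : FractionRing (AdjoinRoot p) →ₐ[K] L,
      φ (algebraMap (AdjoinRoot p) _ (AdjoinRoot.of p X)) = x ∧
      φ (algebraMap (AdjoinRoot p) _ (AdjoinRoot.root p)) = y := by
  have hmonic : p.Monic := hp ▸ monic_X_pow_sub_C F two_ne_zero
  have hdeg : p.natDegree = 2 := by rw [hp]; exact natDegree_X_pow_sub_C
  let ψ₀ : AdjoinRoot p →+* L := AdjoinRoot.lift ((aeval x : K[X] →ₐ[K] L) : K[X] →+* L) y (by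
    rw [hp]; simp [hsq])
  let ψ : AdjoinRoot p →ₐ[K] L :=
    { ψ₀ with
      commutes' := fun c => by
        change ψ₀ (AdjoinRoot.of p (C c)) = _
        simp [ψ₀] }
  have hψx : ψ (AdjoinRoot.of p X) = x := by
    change ψ₀ _ = _
    simp [ψ₀]
  have hψy : ψ (AdjoinRoot.root p) = y := by
    change ψ₀ _ = _
    simp [ψ₀]
  have hinj : Function.Injective ψ := by
    rw [injective_iff_map_eq_zero]
    intro z hz
    obtain ⟨q, rfl⟩ := AdjoinRoot.mk_surjective z
    have hq : (q %ₘ p).natDegree ≤ 1 := by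
      have := natDegree_modByMonic_lt q hmonic (by rintro h; simp [h] at hdeg)
      omega
    obtain ⟨b, a, hab⟩ := exists_eq_X_add_C_of_natDegree_le_one hq
    have e : AdjoinRoot.mk p q = AdjoinRoot.mk p (C b * X + C a) := by
      rw [← hab, AdjoinRoot.mk_eq_mk]
      exact ⟨q /ₘ p, by linear_combination -(modByMonic_add_div q p)⟩
    rw [e] at hz ⊢
    have hz' : ψ₀ (AdjoinRoot.mk p (C b * X + C a)) = 0 := hz
    simp only [ψ₀, AdjoinRoot.lift_mk, eval₂_add, eval₂_mul, eval₂_C, eval₂_X] at hz'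
    obtain ⟨rfl, rfl⟩ := hind a b (by rw [add_comm]; exact hz')
    simp
  refine ⟨IsFractionRing.liftAlgHom (g := ψ) hinj, ?_, ?_⟩
  · rw [IsFractionRing.liftAlgHom_apply, IsFractionRing.lift_algebraMap]; exact hψx
  · rw [IsFractionRing.liftAlgHom_apply, IsFractionRing.lift_algebraMap]; exact hψy

namespace IsHyperelliptic

variable {x y : L} {F : K[X]}

lemma indep_adjoin (h : IsHyperelliptic x y F) {u v : L} (hu : u ∈ IntermediateField.adjoin K {x})
    (hv : v ∈ IntermediateField.adjoin K {x}) (huv : u + v * y = 0) : u = 0 ∧ v = 0 := by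
  rw [IntermediateField.mem_adjoin_simple_iff] at hu hv
  obtain ⟨r, s, rfl⟩ := hu
  obtain ⟨r', s', rfl⟩ := hv
  -- A zero denominator is allowed here and makes the fraction 0.
  by_cases hs : s = 0
  · simp only [hs, map_zero, div_zero, zero_add, true_and] at huv ⊢
    exact (mul_eq_zero.mp huv).resolve_right h.y_ne_zero
  by_cases hs' : s' = 0
  · simp only [hs', map_zero, div_zero, zero_mul, add_zero, and_true] at huv ⊢
    exact huv
  have hs := h.aeval_ne_zero hs
  have hs' := h.aeval_ne_zero hs'
  field_simp at huv
  obtain ⟨h1, h2⟩ := h.indep (r * s') (s * r') (by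
    simp only [map_mul]; linear_combination huv)
  rw [mul_eq_zero] at h1 h2
  constructor
  · rw [h1.resolve_right (by rintro rfl; simp at hs')]; simp
  · rw [h2.resolve_left (by rintro rfl; simp at hs)]; simp

lemma aeval_mem_adjoin (u : L) (hu : u ∈ IntermediateField.adjoin K {x}) (p : K[X]) :
    aeval u p ∈ IntermediateField.adjoin K {x} := by
  rw [aeval_eq_sum_range]
  exact sum_mem fun i _ => IntermediateField.smul_mem _ (pow_mem hu i)

/-- Finitely many functions have a common denominator in `K[x]`. -/
lemma exists_common_denominator (h : IsHyperelliptic x y F) (n : ℕ) (m : ℕ → L) :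
    ∃ (c : K[X]) (a b : ℕ → K[X]), c ≠ 0 ∧
      ∀ i < n, aeval x c * m i = aeval x (a i) + aeval x (b i) * y := by
  choose a b c hc habc using fun i => h.gen (m i)
  have hdvd : ∀ i, ∃ d, i < n → ∏ k ∈ Finset.range n, c k = c i * d := fun i => by
    by_cases hi : i < n
    · obtain ⟨d, hd⟩ := Finset.dvd_prod_of_mem c (Finset.mem_range.mpr hi)
      exact ⟨d, fun _ => hd⟩
    · exact ⟨0, fun h => absurd h hi⟩
  choose d hd using hdvd
  refine ⟨∏ k ∈ Finset.range n, c k, fun i => d i * a i, fun i => d i * b i,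
    Finset.prod_ne_zero_iff.mpr fun i _ => hc i, fun i hi => ?_⟩
  rw [hd i hi]
  simp only [map_mul]
  linear_combination aeval x (d i) * habc i

/-- A relation between derivations that holds for `x` and `y` holds for all functions. -/
lemma derivation_comp_eq (h : IsHyperelliptic x y F) [CharZero K] {φ : L →ₐ[K] M}
    {D : Derivation K M M} {D' : Derivation K L L} {e : M}
    (hx : D (φ x) = e * φ (D' x)) (z : L) : D (φ z) = e * φ (D' z) := by
  have hM : CharZero M := charZero_of_injective_algebraMap (algebraMap K M).injective
  have hp : ∀ p : K[X], D (φ (aeval x p)) = e * φ (D' (aeval x p)) := fun p => by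
    rw [← aeval_algHom_apply, D.map_aeval, D'.map_aeval, hx]
    simp only [smul_eq_mul, map_mul, ← aeval_algHom_apply]
    ring
  have hy : D (φ y) = e * φ (D' y) := by
    have e1 := hp F
    rw [← h.sq, map_pow, D.leibniz_pow, D'.leibniz_pow] at e1
    simp only [Nat.add_one_sub_one, pow_one, nsmul_eq_mul, smul_eq_mul, map_mul, map_natCast] at e1
    have hy0 : φ y ≠ 0 := by simpa using h.y_ne_zero
    apply mul_left_cancel₀ (mul_ne_zero (two_ne_zero (α := M)) hy0)
    push_cast at e1
    linear_combination e1
  obtain ⟨a, b, c, hc, hz⟩ := h.gen z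
  have hc' : φ (aeval x c) ≠ 0 := by simpa using h.aeval_ne_zero hc
  have e1 := congrArg (fun w => D (φ w)) hz
  have e2 := congrArg (fun w => e * φ (D' w)) hz
  simp only [map_mul, map_add, Derivation.leibniz, smul_eq_mul, hp, hy] at e1 e2
  apply mul_left_cancel₀ hc'
  linear_combination e1 - e2

end IsHyperelliptic

end Generic

end Origami

namespace Origami

/-! ### The functions f₁ and f₂, and the degree of the covering -/

section Covering

variable {K L M : Type*} [Field K] [CharZero K] [Field L] [Field M] [Algebra K L] [Algebra K M]
  {g : ℕ} {x y : L} {F : K[X]}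

lemma jSum_X_ne_zero (hg : 1 ≤ g) : jSum g (X : K[X]) ≠ 0 := by
  intro h0
  have h := map_jSum (evalRingHom (0 : K)) g X
  rw [h0, map_zero, coe_evalRingHom, eval_X] at h
  exact jSum_zero_ne_zero hg h.symm

lemma oddSum_zero_ne_zero (hg : 1 ≤ g) : oddSum g (0 : K) ≠ 0 := by
  intro h0
  have h := congrArg (aeval (0 : K)) (jSum_sq_add (K := K) hg)
  have hn : 2 * g - 1 ≠ 0 := by omega
  simp only [map_add, map_mul, map_pow, map_one, aeval_jSum, aeval_oddSum, aeval_X, h0,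
    zero_pow hn] at h
  exact jSum_zero_ne_zero (K := K) hg (by simpa using h)

lemma oddSum_X_ne_zero (hg : 1 ≤ g) : oddSum g (X : K[X]) ≠ 0 := by
  intro h0
  have h := map_oddSum (evalRingHom (0 : K)) g X
  rw [h0, map_zero, coe_evalRingHom, eval_X] at h
  exact oddSum_zero_ne_zero hg h.symm

namespace IsHyperelliptic

variable (h : IsHyperelliptic x y F) (hg : 1 ≤ g)
include h hg

lemma jSum_ne_zero : jSum g x ≠ 0 := by
  rw [← aeval_jSum (K := K)]; exact h.aeval_ne_zero (jSum_X_ne_zero hg)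

lemma oddSum_ne_zero : oddSum g x ≠ 0 := by
  rw [← aeval_oddSum (K := K)]; exact h.aeval_ne_zero (oddSum_X_ne_zero hg)

lemma f₁_ne_zero : f₁ g x ≠ 0 :=
  div_ne_zero (pow_ne_zero _ h.x_ne_zero) (pow_ne_zero _ (h.jSum_ne_zero hg))

lemma f₂_ne_zero : f₂ g x ≠ 0 :=
  div_ne_zero (mul_ne_zero (pow_ne_zero _ h.x_ne_zero) (h.oddSum_ne_zero hg))
    (pow_ne_zero _ (h.jSum_ne_zero hg))

omit [CharZero K] h hg in
lemma f₁_mem_adjoin : f₁ g x ∈ IntermediateField.adjoin K {x} := by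
  have hx := IntermediateField.mem_adjoin_simple_self K x
  rw [f₁, ← aeval_jSum (K := K)]
  exact div_mem (pow_mem hx _) (pow_mem (aeval_mem_adjoin x hx _) _)

omit [CharZero K] h hg in
lemma f₂_mem_adjoin : f₂ g x ∈ IntermediateField.adjoin K {x} := by
  have hx := IntermediateField.mem_adjoin_simple_self K x
  rw [f₂, ← aeval_jSum (K := K), ← aeval_oddSum (K := K)]
  exact div_mem (mul_mem (pow_mem hx _) (aeval_mem_adjoin x hx _))
    (pow_mem (aeval_mem_adjoin x hx _) _)

omit hg h in
lemma jSum_notMem_nonunits (hg : 1 ≤ g) (P : Point K L) (hx : x ∈ P.ring.nonunits) :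
    jSum g x ∉ P.ring.nonunits := by
  rw [← aeval_jSum (K := K), P.aeval_mem_nonunits_iff hx, ← coe_aeval_eq_eval, aeval_jSum]
  exact jSum_zero_ne_zero hg

omit hg h in
lemma oddSum_notMem_nonunits (hg : 1 ≤ g) (P : Point K L) (hx : x ∈ P.ring.nonunits) :
    oddSum g x ∉ P.ring.nonunits := by
  rw [← aeval_oddSum (K := K), P.aeval_mem_nonunits_iff hx, ← coe_aeval_eq_eval, aeval_oddSum]
  exact oddSum_zero_ne_zero hg

/-- The function `f₁(x)` vanishes exactly at the zeros of `x`. -/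
lemma f₁_mem_nonunits_iff (P : Point K L) :
    f₁ g x ∈ P.ring.nonunits ↔ x ∈ P.ring.nonunits := by
  have hj := h.jSum_ne_zero hg
  have hx0 := h.x_ne_zero
  constructor
  · intro hf
    by_cases hx : x ∈ P.ring
    · refine P.mem_nonunits_of_pow_mem (n := 2 * g - 1) ?_
      have e : x ^ (2 * g - 1) = jSum g x ^ 2 * f₁ g x := by
        rw [f₁]; field_simp
      rw [e]
      refine P.mul_mem_nonunits (pow_mem ?_ 2) hf
      rw [← aeval_jSum (K := K)]
      exact P.aeval_mem hx _
    · exfalso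
      have hx' := P.inv_mem_nonunits_of_notMem hx
      have e := aeval_inv_reflect_mul_pow hx0 (natDegree_jSum_le (K := K) g)
      have hr := P.aeval_mem (P.mem_of_mem_nonunits hx') (reflect (g - 1) (jSum g (X : K[X])))
      rw [aeval_jSum] at e
      generalize aeval x⁻¹ (reflect (g - 1) (jSum g (X : K[X]))) = r at e hr
      -- At infinity j(x) = r x^(g-1) with r regular, so f₁ = x/r² has a pole.
      have e1 : (r ^ 2 * x⁻¹) * f₁ g x = 1 := by
        have e2 : x ^ (2 * g - 1) = (x ^ (g - 1)) ^ 2 * x := by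
          rw [← pow_mul, ← pow_succ]; congr 1; omega
        rw [f₁, e2, ← e]
        have hr0 : r ≠ 0 := by
          rintro rfl
          exact hj (by rw [← e, zero_mul])
        field_simp
      exact P.one_notMem_nonunits (e1 ▸ P.mul_mem_nonunits
        (mul_mem (pow_mem hr 2) (P.mem_of_mem_nonunits hx')) hf)
  · intro hx
    have e : f₁ g x = ((jSum g x)⁻¹ ^ 2 * x ^ (2 * g - 2)) * x := by
      rw [f₁, mul_assoc, ← pow_succ, show 2 * g - 2 + 1 = 2 * g - 1 by omega]; field_simp
    rw [e]
    exact P.mul_mem_nonunits (mul_mem (pow_mem (P.inv_mem (jSum_notMem_nonunits hg P hx)) 2)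
      (pow_mem (P.mem_of_mem_nonunits hx) _)) hx

/-- The powers `1, x, …, x^{2g-2}` are linearly independent over `K[f₁(x)]`. -/
lemma eq_zero_of_sum_aeval_f₁ (hF : F.eval 0 = 0) (a : ℕ → K[X])
    (ha : ∑ i ∈ Finset.range (2 * g - 1), aeval (f₁ g x) (a i) * x ^ i = 0) :
    ∀ i < 2 * g - 1, a i = 0 := by
  obtain ⟨P, hP⟩ := h.exists_point_zero hF
  have hPx := P.mem_of_mem_nonunits hP
  have hf := (h.f₁_mem_nonunits_iff hg P).mpr hP
  have hf0 := h.f₁_ne_zero hg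
  have hj := jSum_notMem_nonunits hg P hP
  have hfx : f₁ g x = x ^ (2 * g - 1) * (jSum g x)⁻¹ ^ 2 := by
    rw [f₁, div_eq_mul_inv, inv_pow]
  set n := 2 * g - 1
  have hsplit : ∀ p : K[X], aeval (f₁ g x) p =
      f₁ g x * aeval (f₁ g x) p.divX + algebraMap K L (p.eval 0) := fun p => by
    conv_lhs => rw [← divX_mul_X_add p]
    simp [coeff_zero_eq_eval_zero, mul_comm]
  -- Modulo f₁, a unit times x^n at (0,0), the relation becomes a polynomial in x of degree below n
  -- that is divisible by x^n, so it vanishes.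
  have hconst : ∀ a : ℕ → K[X], ∑ i ∈ Finset.range n, aeval (f₁ g x) (a i) * x ^ i = 0 →
      ∀ i < n, (a i).eval 0 = 0 := by
    intro a ha
    set p : K[X] := ∑ i ∈ Finset.range n, C ((a i).eval 0) * X ^ i with hp
    have hpc : ∀ i < n, p.coeff i = (a i).eval 0 := fun i hi => by
      simp [hp, finsetSum_coeff, coeff_X_pow, hi]
    suffices hp0 : p = 0 by
      intro i hi
      rw [← hpc i hi, hp0, coeff_zero]
    by_contra hp0
    have hpn : p.degree < n := by
      rw [hp, ← mem_degreeLT]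
      refine Submodule.sum_mem _ fun i hi => ?_
      rw [mem_degreeLT]
      exact (degree_C_mul_X_pow_le _ _).trans_lt (by exact_mod_cast Finset.mem_range.mp hi)
    have hpn := (natDegree_lt_iff_degree_lt hp0).mpr hpn
    have e : aeval x p =
        -(f₁ g x * ∑ i ∈ Finset.range n, aeval (f₁ g x) (a i).divX * x ^ i) := by
      rw [eq_neg_iff_add_eq_zero, ← ha, hp, map_sum, Finset.mul_sum, ← Finset.sum_add_distrib]
      refine Finset.sum_congr rfl fun i _ => ?_
      rw [hsplit (a i)]
      simp only [map_mul, aeval_C, map_pow, aeval_X]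
      ring
    have hw : ∑ i ∈ Finset.range n, aeval (f₁ g x) (a i).divX * x ^ i ∈ P.ring :=
      sum_mem fun i _ => mul_mem (P.aeval_mem (P.mem_of_mem_nonunits hf) _) (pow_mem hPx i)
    generalize ∑ i ∈ Finset.range n, aeval (f₁ g x) (a i).divX * x ^ i = w at e hw
    obtain ⟨q, hq, hq'⟩ := exists_eq_pow_rootMultiplicity_mul_and_not_dvd p hp0 0
    rw [map_zero, sub_zero] at hq hq'
    have hk : rootMultiplicity 0 p < n := by
      have h1 := natDegree_le_of_dvd (pow_rootMultiplicity_dvd p 0) hp0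
      rw [natDegree_pow, natDegree_X_sub_C, mul_one] at h1
      exact h1.trans_lt hpn
    generalize rootMultiplicity 0 p = k at hq hk
    rw [X_dvd_iff, coeff_zero_eq_eval_zero, ← P.aeval_mem_nonunits_iff hP] at hq'
    apply hq'
    have e2 : aeval x q = (-((jSum g x)⁻¹ ^ 2 * w) * x ^ (n - k - 1)) * x := by
      apply mul_left_cancel₀ (pow_ne_zero k h.x_ne_zero)
      have e3 : x ^ n = x ^ k * x ^ (n - k - 1) * x := by
        rw [← pow_add, ← pow_succ]; congr 1; omega
      have e4 : x ^ k * aeval x q = aeval x p := by rw [hq]; simp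
      rw [e4, e, hfx, e3]
      ring
    rw [e2]
    exact P.mul_mem_nonunits (mul_mem (neg_mem (mul_mem (pow_mem (P.inv_mem hj) 2) hw))
      (pow_mem hPx _)) hP
  -- With all constant terms zero, the relation can be divided by f₁ and the argument repeated.
  have hdvd : ∀ N : ℕ, ∀ a : ℕ → K[X],
      ∑ i ∈ Finset.range n, aeval (f₁ g x) (a i) * x ^ i = 0 → ∀ i < n, X ^ N ∣ a i := by
    intro N
    induction N with
    | zero => intro a _ i _; simp
    | succ N ih =>
      intro a ha i hi
      have h0 := hconst a ha
      have h1 := ih (fun i => (a i).divX) (by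
        apply mul_left_cancel₀ hf0
        rw [mul_zero, ← ha, Finset.mul_sum]
        refine Finset.sum_congr rfl fun i hi => ?_
        rw [hsplit (a i), h0 i (Finset.mem_range.mp hi)]
        simp only [map_zero]
        ring) i hi
      rw [← divX_mul_X_add (a i), coeff_zero_eq_eval_zero, h0 i hi, C_0, add_zero, pow_succ]
      exact mul_dvd_mul_right h1 X
  intro i hi
  refine eq_zero_of_dvd_of_natDegree_lt (hdvd ((a i).natDegree + 1) a ha i hi) ?_
  rw [natDegree_X_pow]
  exact Nat.lt_succ_self _

/-- f₁ is transcendental because it vanishes at (0,0) without being zero. This makes the comorphism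
injective on the coordinate ring of E_t. -/
lemma f₁_indep (hF : F.eval 0 = 0) (a b : K[X])
    (hab : aeval (f₁ g x) a + aeval (f₁ g x) b * (f₂ g x * y) = 0) : a = 0 ∧ b = 0 := by
  obtain ⟨P, hP⟩ := h.exists_point_zero hF
  have ht := P.transcendental_of_mem_nonunits ((h.f₁_mem_nonunits_iff hg P).mpr hP)
    (h.f₁_ne_zero hg)
  rw [← mul_assoc] at hab
  obtain ⟨h1, h2⟩ := h.indep_adjoin (aeval_mem_adjoin _ f₁_mem_adjoin a)
    (mul_mem (aeval_mem_adjoin _ f₁_mem_adjoin b) f₂_mem_adjoin) hab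
  rw [mul_eq_zero, or_iff_left (h.f₂_ne_zero hg)] at h2
  exact ⟨transcendental_iff.mp ht a h1, transcendental_iff.mp ht b h2⟩

end IsHyperelliptic

/-- The extension of function fields defined by `(x, y) ↦ (f₁(x), f₂(x) y)` has degree `2 g - 1`. -/
lemma finiteDimensional_and_finrank_eq [Algebra M L] [IsScalarTower K M L]
    (h : IsHyperelliptic x y F) (hg : 1 ≤ g) (hF : F.eval 0 = 0) {x' y' : M} {F' : K[X]}
    (h' : IsHyperelliptic x' y' F') (hx' : algebraMap M L x' = f₁ g x)
    (hy' : algebraMap M L y' = f₂ g x * y) :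
    FiniteDimensional M L ∧ Module.finrank M L = 2 * g - 1 := by
  have hmap : ∀ p : K[X], algebraMap M L (aeval x' p) = aeval (f₁ g x) p := fun p => by
    rw [← hx', aeval_algebraMap_apply]
  -- x is a root because f₁ j(x)² = x^n; q is monic of degree n because j² has degree at most 2g-2.
  set q : M[X] := X ^ (2 * g - 1) - C x' * (jSum g (X : K[X])).map (algebraMap K M) ^ 2 with hq
  have hlt : (C x' * (jSum g (X : K[X])).map (algebraMap K M) ^ 2).natDegree < 2 * g - 1 := by
    have h1 := natDegree_jSum_le (K := K) g
    have h2 := natDegree_map_le (f := algebraMap K M) (p := jSum g (X : K[X]))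
    have h3 := natDegree_C_mul_le x' ((jSum g (X : K[X])).map (algebraMap K M) ^ 2)
    have h4 := natDegree_pow_le (p := (jSum g (X : K[X])).map (algebraMap K M)) (n := 2)
    omega
  have hqn : q.natDegree = 2 * g - 1 := by
    rw [hq, natDegree_sub_eq_left_of_natDegree_lt (by rwa [natDegree_X_pow]), natDegree_X_pow]
  have hqm : q.Monic :=
    monic_X_pow_sub (degree_le_natDegree.trans_lt (by exact_mod_cast hlt))
  have hqx : aeval x q = 0 := by
    have hj := h.jSum_ne_zero hg
    simp only [hq, map_sub, map_pow, map_mul, aeval_X, aeval_C, aeval_map_algebraMap, aeval_jSum,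
      hx', f₁]
    field_simp
    ring
  have hint : IsIntegral M x := ⟨q, hqm, hqx⟩
  have htop : IntermediateField.adjoin M {x} = ⊤ := by
    rw [eq_top_iff]
    intro z _
    have hx : x ∈ IntermediateField.adjoin M {x} := IntermediateField.mem_adjoin_simple_self M x
    have hp : ∀ p : K[X], aeval x p ∈ IntermediateField.adjoin M {x} := fun p => by
      rw [← aeval_map_algebraMap M]
      exact IsHyperelliptic.aeval_mem_adjoin x hx _
    have hy : y ∈ IntermediateField.adjoin M {x} := by
      have e : y = algebraMap M L y' / f₂ g x := by
        rw [hy', mul_div_cancel_left₀ _ (h.f₂_ne_zero hg)]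
      rw [e, f₂, ← aeval_jSum (K := K), ← aeval_oddSum (K := K)]
      exact div_mem (IntermediateField.algebraMap_mem _ _)
        (div_mem (mul_mem (pow_mem hx _) (hp _)) (pow_mem (hp _) _))
    obtain ⟨a, b, c, hc, hz⟩ := h.gen z
    have e : z = (aeval x a + aeval x b * y) / aeval x c := by
      rw [← hz, mul_div_cancel_left₀ _ (h.aeval_ne_zero hc)]
    rw [e]
    exact div_mem (add_mem (hp a) (mul_mem (hp b) hy)) (hp c)
  have hrank : Module.finrank M L = (minpoly M x).natDegree := by
    rw [← IntermediateField.adjoin.finrank hint, htop, IntermediateField.finrank_top']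
  refine ⟨?_, ?_⟩
  · exact FiniteDimensional.of_finrank_pos (hrank ▸ minpoly.natDegree_pos hint)
  rw [hrank]
  refine le_antisymm (hqn ▸ natDegree_le_of_dvd (minpoly.dvd M x hqx) hqm.ne_zero) ?_
  by_contra! hlt
  apply minpoly.ne_zero hint
  have hr := minpoly.aeval M x
  generalize minpoly M x = r at *
  obtain ⟨c, a, b, hc, hab⟩ := h'.exists_common_denominator (2 * g - 1) r.coeff
  -- A minimal polynomial of degree below n, cleared of denominators, splits into a part in K(x) and
  -- a multiple of y; each is a relation over K[f₁].
  have hsum : ∑ i ∈ Finset.range (2 * g - 1), aeval (f₁ g x) (a i) * x ^ i +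
      (f₂ g x * ∑ i ∈ Finset.range (2 * g - 1), aeval (f₁ g x) (b i) * x ^ i) * y = 0 := by
    rw [aeval_eq_sum_range' hlt] at hr
    have h0 := congrArg (algebraMap M L (aeval x' c) * ·) hr
    simp only [mul_zero, Finset.mul_sum] at h0
    rw [← h0, Finset.mul_sum, Finset.sum_mul, ← Finset.sum_add_distrib]
    refine Finset.sum_congr rfl fun i hi => ?_
    have e := congrArg (algebraMap M L) (hab i (Finset.mem_range.mp hi))
    simp only [map_mul, map_add, hmap, hy'] at e
    rw [Algebra.smul_def, hmap]
    linear_combination (-x ^ i) * e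
  have hmem : ∀ a : ℕ → K[X], ∑ i ∈ Finset.range (2 * g - 1), aeval (f₁ g x) (a i) * x ^ i ∈
      IntermediateField.adjoin K {x} := fun a =>
    sum_mem fun i _ => mul_mem
      (IsHyperelliptic.aeval_mem_adjoin _ IsHyperelliptic.f₁_mem_adjoin _)
      (pow_mem (IntermediateField.mem_adjoin_simple_self K x) i)
  obtain ⟨h1, h2⟩ := h.indep_adjoin (hmem a) (mul_mem IsHyperelliptic.f₂_mem_adjoin (hmem b)) hsum
  rw [mul_eq_zero, or_iff_right (h.f₂_ne_zero hg)] at h2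
  have ha := h.eq_zero_of_sum_aeval_f₁ hg hF a h1
  have hb := h.eq_zero_of_sum_aeval_f₁ hg hF b h2
  ext i
  rw [coeff_zero]
  by_cases hi : i < 2 * g - 1
  · have e := hab i hi
    rw [ha i hi, hb i hi, map_zero, zero_mul, add_zero, mul_eq_zero] at e
    exact e.resolve_left (h'.aeval_ne_zero hc)
  · exact coeff_eq_zero_of_natDegree_lt (by omega)

end Covering

end Origami

namespace Origami

/-! ### The equation of E_t, the pullback of dx/y and the ramification -/

section Covering

variable {K L M : Type*} [Field K] [CharZero K] [Field L] [Field M] [Algebra K L] [Algebra K M]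
  {g : ℕ} {x y : L} {F : K[X]}

/-- The point `(f₁(x), f₂(x) y)` lies on `E_t`. -/
lemma IsHyperelliptic.f₂_mul_sq {t : K} (h : IsHyperelliptic x y (curvePoly g t)) (hg : 1 ≤ g) :
    (f₂ g x * y) ^ 2 = aeval (f₁ g x) (curvePoly 1 t) := by
  have hj := h.jSum_ne_zero hg
  have e := congrArg (aeval x) (jSum_sq_add (K := K) hg)
  have hs := h.sq
  rw [curvePoly_one]
  simp only [curvePoly, map_mul, map_add, map_pow, map_one, aeval_X, aeval_C, aeval_jSum,
    aeval_oddSum] at hs e ⊢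
  have e2 : x ^ (2 * g - 1) = (x ^ (g - 1)) ^ 2 * x := by
    rw [← pow_mul, ← pow_succ]; congr 1; omega
  rw [mul_pow, hs, f₁, f₂]
  have e3 : x ^ (2 * g - 1) / jSum g x ^ 2 + 1 = (x + 1) * oddSum g x ^ 2 / jSum g x ^ 2 := by
    rw [← e]; field_simp; ring
  rw [e3]
  generalize algebraMap K L t = T
  field_simp
  rw [e2]
  ring

/-- The pullback of `dx / y` is `(2 g - 1) x^{g-1} dx / y`. -/
lemma IsHyperelliptic.derivation_f₁ (h : IsHyperelliptic x y F) (hg : 1 ≤ g)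
    {D : Derivation K L L} (hD : D x = y) :
    D (f₁ g x) = ((2 * g - 1 : ℕ) * x ^ (g - 1)) * (f₂ g x * y) := by
  have hj := h.jSum_ne_zero hg
  have e0 : f₁ g x * jSum g x ^ 2 = x ^ (2 * g - 1) := by rw [f₁]; field_simp
  have i := congrArg (aeval x) (derivative_jSum (K := K) hg)
  have hDj : D (jSum g x) = aeval x (derivative (jSum g (X : K[X]))) * y := by
    rw [← aeval_jSum (K := K), D.map_aeval, hD, smul_eq_mul]
  have e1 := congrArg D e0
  rw [D.leibniz, D.leibniz_pow, D.leibniz_pow, hD, hDj] at e1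
  simp only [map_sub, map_mul, map_natCast, map_ofNat, aeval_X, aeval_jSum, aeval_oddSum,
    nsmul_eq_mul, smul_eq_mul, Nat.add_one_sub_one, pow_one] at i e1
  have p1 : x ^ (2 * g - 1) = (x ^ (g - 1)) ^ 2 * x := by
    rw [← pow_mul, ← pow_succ]; congr 1; omega
  have p2 : x ^ (2 * g - 1 - 1) = (x ^ (g - 1)) ^ 2 := by
    rw [← pow_mul]; congr 1; omega
  have e2 : f₂ g x * jSum g x ^ 3 = x ^ (g - 1) * oddSum g x := by rw [f₂]; field_simp
  rw [p2] at e1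
  rw [p1] at e0
  apply mul_right_cancel₀ (pow_ne_zero 3 hj)
  push_cast at e1
  linear_combination jSum g x * e1 - 2 * aeval x (derivative (jSum g (X : K[X]))) * y * e0
    + (x ^ (g - 1)) ^ 2 * y * i - ((2 * g - 1 : ℕ) : L) * x ^ (g - 1) * y * e2

/-- The covering is unramified away from the zeros of `x`. -/
lemma IsHyperelliptic.ramificationIdx_eq_one (h : IsHyperelliptic x y F) (hg : 1 ≤ g)
    (hFdeg : F.natDegree = 2 * g + 1) {x' y' : M} {F' : K[X]} (h' : IsHyperelliptic x' y' F')
    (hFdeg' : F'.natDegree = 3) (f : CurveMap K L M) (hx' : f.pullback x' = f₁ g x)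
    (hy' : f.pullback y' = f₂ g x * y) (P : Point K L) (hP : x ∉ P.ring.nonunits) :
    f.ramificationIdx P = 1 := by
  obtain ⟨D, hD⟩ := h.exists_derivation
  obtain ⟨D', hD'⟩ := h'.exists_derivation
  have hx0 := h.x_ne_zero
  have hn : ((2 * g - 1 : ℕ) : K) ≠ 0 := by
    rw [Nat.cast_ne_zero]; omega
  have hnP : ((2 * g - 1 : ℕ) : L) ∉ P.ring.nonunits := by
    simpa using P.algebraMap_notMem_nonunits hn
  have hDD' : ∀ v : M, D (f.pullback v) =
      ((2 * g - 1 : ℕ) * x ^ (g - 1)) * f.pullback (D' v) :=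
    h'.derivation_comp_eq (by rw [hx', hD', hy', h.derivation_f₁ hg hD])
  have hQ : ∃ v ∈ (f.onPoints P).ring.nonunits, D' v ∉ (f.onPoints P).ring.nonunits := by
    rcases (f.onPoints P).ring.mem_or_inv_mem x' with hx | hx
    · exact h'.exists_derivation_notMem_nonunits hD' _ hx
    -- For genus 1 the factor x^(g-1) is 1, so -D' is the derivation of the chart at infinity.
    · obtain ⟨v, hv, hv'⟩ := (h'.atInfinity (g := 1) hFdeg').exists_derivation_notMem_nonunits
        (h'.smul_derivation_inv hD' le_rfl) _ hx
      refine ⟨v, hv, fun hm => hv' ?_⟩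
      simpa using hm
  rcases P.ring.mem_or_inv_mem x with hx | hx
  · refine f.ramificationIdx_eq_one P (fun z hz => h.derivation_mem hD P hx hz) ?_ hDD' hQ
    exact fun hm => hP (P.mem_nonunits_of_pow_mem (P.mem_nonunits_of_mul_mem hm hnP))
  -- The derivation at infinity is -D/x^(g-1), which cancels the factor x^(g-1) and leaves the
  -- constant -n.
  · refine f.ramificationIdx_eq_one P (e := -((2 * g - 1 : ℕ) : L))
      (fun z hz => (h.atInfinity hFdeg).derivation_mem (h.smul_derivation_inv hD hg) P hx hz)
      ?_ ?_ hQ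
    · rwa [neg_mem_iff]
    · intro v
      rw [Derivation.smul_apply, hDD', smul_eq_mul]
      have := pow_ne_zero (g - 1) hx0
      field_simp

/-- The covering is totally ramified at the zero of `x`. -/
lemma IsHyperelliptic.ramificationIdx_eq (h : IsHyperelliptic x y F) (hg : 1 ≤ g)
    (hF : F.eval 0 = 0) {x' y' : M} {F' : K[X]} (h' : IsHyperelliptic x' y' F')
    (hF' : F'.eval 0 = 0) (f : CurveMap K L M) (hx' : f.pullback x' = f₁ g x)
    (hy' : f.pullback y' = f₂ g x * y) (P : Point K L) (hP : x ∈ P.ring.nonunits) :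
    f.ramificationIdx P = 2 * g - 1 := by
  have hQ : x' ∈ (f.onPoints P).ring.nonunits := by
    rw [f.mem_onPoints_nonunits_iff, hx', h.f₁_mem_nonunits_iff hg]
    exact hP
  obtain ⟨w, hw, hw', hxw⟩ := h.exists_x_eq hF P hP
  have hPx := P.mem_of_mem_nonunits hP
  have hj := IsHyperelliptic.jSum_notMem_nonunits hg P hP
  have hj0 := h.jSum_ne_zero hg
  have ho := IsHyperelliptic.oddSum_notMem_nonunits hg P hP
  have hjP : jSum g x ∈ P.ring := by rw [← aeval_jSum (K := K)]; exact P.aeval_mem hPx _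
  have hoP : oddSum g x ∈ P.ring := by rw [← aeval_oddSum (K := K)]; exact P.aeval_mem hPx _
  have hε : w ^ (g - 1) * oddSum g x ∉ P.ring.nonunits := fun hm => by
    rw [mul_comm] at hm
    exact hw' (P.mem_nonunits_of_pow_mem (P.mem_nonunits_of_mul_mem hm ho))
  refine f.ramificationIdx_eq_of_uniformizer P (ϖ := y') (y := y)
    (ε := (jSum g x)⁻¹ ^ 3 * (w ^ (g - 1) * oddSum g x)) (h'.y_mem_nonunits hF' _ hQ)
    (fun v hv => h'.exists_eq_y_mul hF' _ hQ hv) (h.y_mem_nonunits hF P hP) h.y_ne_zero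
    (fun v hv => h.exists_eq_y_mul hF P hP hv)
    (mul_mem (pow_mem (P.inv_mem hj) 3) (mul_mem (pow_mem hw _) hoP)) ?_ ?_
  · intro hm
    apply hε
    have := P.mul_mem_nonunits (pow_mem hjP 3) hm
    rwa [← mul_assoc, ← mul_pow, mul_inv_cancel₀ hj0, one_pow, one_mul] at this
  -- Substituting x = w y² into x^(g-1) y gives the exponent 2(g-1) + 1.
  · have e1 : x ^ (g - 1) = w ^ (g - 1) * y ^ (2 * g - 2) := by
      conv_lhs => rw [hxw, mul_pow, ← pow_mul]
      congr 2
      omega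
    have e2 : y ^ (2 * g - 1) = y ^ (2 * g - 2) * y := by
      rw [← pow_succ]; congr 1; omega
    rw [hy', f₂, e1, e2]
    field_simp

omit [CharZero K] in
/-- The covering maps the point `(a, b)` to `(f₁(a), f₂(a) b)`. -/
lemma isAt_onPoints {x' y' : M} (f : CurveMap K L M)
    (hx' : f.pullback x' = f₁ g x) (hy' : f.pullback y' = f₂ g x * y) (P : Point K L) (a b : K)
    (hP : P.IsAt x y a b) (ha : jSum g a ≠ 0) :
    (f.onPoints P).IsAt x' y' (f₁ g a) (f₂ g a * b) := by
  have hj : ∀ k, (jSum g (X : K[X]) ^ k).eval a ≠ 0 := fun k => by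
    rw [← coe_aeval_eq_eval, map_pow, aeval_jSum]
    exact pow_ne_zero k ha
  obtain ⟨-, h1⟩ := P.div_sub_mem_nonunits hP.1 (X ^ (2 * g - 1)) (jSum g X ^ 2) (hj 2)
  obtain ⟨h2, h3⟩ := P.div_sub_mem_nonunits hP.1 (X ^ (g - 1) * oddSum g X) (jSum g X ^ 3) (hj 3)
  simp only [← coe_aeval_eq_eval, map_pow, map_mul, aeval_X, aeval_jSum, aeval_oddSum]
    at h1 h2 h3
  constructor
  · rw [f.mem_onPoints_nonunits_iff, map_sub, hx', AlgHom.commutes]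
    exact h1
  · rw [f.mem_onPoints_nonunits_iff, map_sub, hy', AlgHom.commutes]
    have e : f₂ g x * y - algebraMap K L (f₂ g a * b) =
        f₂ g x * (y - algebraMap K L b) + algebraMap K L b *
          (f₂ g x - algebraMap K L (f₂ g a)) := by
      rw [map_mul]; ring
    rw [e]
    exact add_mem (P.mul_mem_nonunits h2 hP.2) (P.mul_mem_nonunits (P.algebraMap_mem b) h3)

end Covering

end Origami

open Origami in
theorem theorem3p2 {K : Type*} [Field K] [CharZero K] (g : ℕ) (hg : 1 ≤ g) (t : K)
    (ht0 : t ≠ 0) (ht1 : t ≠ 1) :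
    -- `E_t` is an elliptic curve
    (curveE t).IsElliptic ∧
    -- the affine curve `C_t` is smooth, and its smooth projective model has genus `g`
    (∀ a b : AlgebraicClosure K, b ^ 2 = aeval a (curvePoly g t) →
      b ≠ 0 ∨ aeval a (derivative (curvePoly g t)) ≠ 0) ∧
    genus K (CurveField g t) = g ∧
    -- the map `(x, y) ↦ (f₁(x), f₂(x) y)`
    ∃ f : CurveMap K (CurveField g t) (curveE t).FunctionField,
      f.pullback (xE t) = f₁ g (xC g t) ∧
      f.pullback (yE t) = f₂ g (xC g t) * yC g t ∧
      (∀ (P : Point K (CurveField g t)) (a b : K), P.IsAt (xC g t) (yC g t) a b → jSum g a ≠ 0 →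
        (f.onPoints P).IsAt (xE t) (yE t) (f₁ g a) (f₂ g a * b)) ∧
      f.degree = 2 * g - 1 ∧
      -- `P₀` is the point `(0, 0)` of `C_t` and `Q₀` the point `(0, 0)` of `E_t`
      ∃ (P₀ : Point K (CurveField g t)) (Q₀ : Point K (curveE t).FunctionField),
        (∀ P : Point K (CurveField g t), P.IsAt (xC g t) (yC g t) 0 0 ↔ P = P₀) ∧
        (∀ Q : Point K (curveE t).FunctionField, Q.IsAt (xE t) (yE t) 0 0 ↔ Q = Q₀) ∧
        -- `f` is totally ramified above `Q₀` and unramified everywhere else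
        (∀ P : Point K (CurveField g t), f.onPoints P = Q₀ ↔ P = P₀) ∧
        f.ramificationIdx P₀ = 2 * g - 1 ∧
        ∀ P : Point K (CurveField g t), P ≠ P₀ → f.ramificationIdx P = 1 := by
  have hC := isHyperelliptic_C hg ht0 ht1
  have hE := isHyperelliptic_E ht0 ht1
  have hFC := eval_zero_curvePoly g t
  have hFE := eval_zero_curvePoly 1 t
  refine ⟨curveE_isElliptic ht0 ht1, ?_, hC.genus_eq hg (natDegree_curvePoly hg t), ?_⟩
  · intro a b hab
    have h := (isCoprime_iff_aeval_ne_zero_of_isAlgClosed K (AlgebraicClosure K) _ _).mp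
      hC.separable a
    rw [← hab] at h
    exact h.imp_left fun h0 hb => h0 (by rw [hb, zero_pow two_ne_zero])
  obtain ⟨φ, hφx, hφy⟩ : ∃ φ : (curveE t).FunctionField →ₐ[K] CurveField g t,
      φ (xE t) = f₁ g (xC g t) ∧ φ (yE t) = f₂ g (xC g t) * yC g t :=
    exists_algHom_adjoinRoot (curveE_polynomial t) (hC.f₂_mul_sq hg) (hC.f₁_indep hg hFC)
  have hdeg : φ.toRingHom.Finite ∧
      (letI := φ.toRingHom.toAlgebra
       Module.finrank (curveE t).FunctionField (CurveField g t)) = 2 * g - 1 := by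
    let := φ.toRingHom.toAlgebra
    have : IsScalarTower K (curveE t).FunctionField (CurveField g t) :=
      IsScalarTower.of_algebraMap_eq fun c => (φ.commutes c).symm
    exact finiteDimensional_and_finrank_eq hC hg hFC hE hφx hφy
  let f : CurveMap K (CurveField g t) (curveE t).FunctionField := ⟨φ, hdeg.1⟩
  obtain ⟨P₀, hP₀⟩ := hC.exists_point_zero hFC
  obtain ⟨Q₀, hQ₀⟩ := hE.exists_point_zero hFE
  have hP₀' : ∀ P : Point K (CurveField g t), xC g t ∈ P.ring.nonunits ↔ P = P₀ := fun P =>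
    ⟨fun hP => hC.point_zero_unique hFC hP hP₀, fun hP => hP ▸ hP₀⟩
  have hQ₀' : ∀ Q : Point K (curveE t).FunctionField, xE t ∈ Q.ring.nonunits ↔ Q = Q₀ := fun Q =>
    ⟨fun hQ => hE.point_zero_unique hFE hQ hQ₀, fun hQ => hQ ▸ hQ₀⟩
  refine ⟨f, hφx, hφy, isAt_onPoints f hφx hφy, hdeg.2, P₀, Q₀, ?_, ?_, ?_,
    hC.ramificationIdx_eq hg hFC hE hFE f hφx hφy P₀ hP₀, ?_⟩
  · exact fun P => (hC.isAt_zero_iff hFC P).trans (hP₀' P)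
  · exact fun Q => (hE.isAt_zero_iff hFE Q).trans (hQ₀' Q)
  · intro P
    rw [← hQ₀', ← hP₀', f.mem_onPoints_nonunits_iff, ← hC.f₁_mem_nonunits_iff hg]
    exact iff_of_eq (congrArg (· ∈ P.ring.nonunits) hφx)
  · intro P hP
    exact hC.ramificationIdx_eq_one hg (natDegree_curvePoly hg t) hE
      (natDegree_curvePoly le_rfl t) f hφx hφy P (fun h => hP ((hP₀' P).mp h))
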